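/- Fix $p\in(0,1)$. A sandpile configuration is a finitely supported function $\eta:\mathbb Z\to\mathbb N$; a vertex $v$ is unstable if $\eta(v)\ge 2$, and $\eta$ is stable if no vertex is unstable. Let $(\xi_{x,i})_{x\in\mathbb Z,\,i\in\mathbb N}$ be independent random toppling instructions with values in $\{\leftarrow,\rightarrow,\leftrightarrow,\varnothing\}$ and $$\mathbb P(\xi_{x,i}=\leftarrow)=\mathbb P(\xi_{x,i}=\rightarrow)=p(1-p),\qquad \mathbb P(\xi_{x,i}=\leftrightarrow)=p^2,\qquad \mathbb P(\xi_{x,i}=\varnothing)=(1-p)^2 .$$ Executed at $x$, the instruction $\leftarrow$ moves one particle from $x$ to $x-1$, $\rightarrow$ moves one particle from $x$ to $x+1$, $\leftrightarrow$ moves one particle from $x$ to each of $x-1$ and $x+1$, and $\varnothing$ changes nothing. For $n\in\mathbb N$ let $\eta^{(n)}_0=n\delta_0$ ($n$ particles at the origin). If $\eta^{(n)}_k$ is unstable, $\eta^{(n)}_{k+1}$ is obtained from it by executing, at its leftmost unstable vertex $x$, the instruction $\xi_{x,u}$, where $u$ is the number of earlier topplings at $x$; if $\eta^{(n)}_k$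 is stable, $\eta^{(n)}_{k+1}=\eta^{(n)}_k$. Let $K_n=\inf\{k\in\mathbb N:\eta^{(n)}_k\text{ is stable}\}$ be the stabilization time. Then, for every $n$, $K_n<\infty$ almost surely, so that the final stable configuration $\eta^{(n)}=\eta^{(n)}_{K_n}$ is well defined almost surely. Its center of mass $$M^{(n)}_{K_n}=\sum_{x\in\mathbb Z}x\cdot\eta^{(n)}(x)$$ satisfies, as $n\to\infty$, $$\frac{M^{(n)}_{K_n}}{n^{3/2}}\xrightarrow{\ \mathcal D\ }\mathcal N\Big(0,\frac{1-p}{12}\Big).$$ -/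

import Mathlib

open MeasureTheory ProbabilityTheory Filter

namespace StochasticSandpile

/-- The four toppling instructions: send one particle to the left neighbour, one to the right
neighbour, one to each neighbour, or none at all. -/
inductive Instruction : Type where
  | left : Instruction
  | right : Instruction
  | both : Instruction
  | nothing : Instruction

instance instMeasurableSpaceInstruction : MeasurableSpace Instruction := ⊤

instance instDiscreteMeasurableSpaceInstruction : DiscreteMeasurableSpace Instruction :=
  ⟨fun _ => trivial⟩

/-- Finitely supported sandpile configurations on the integers. -/
abbrev Config : Type := ℤ →₀ ℕ

/-- A configuration is stable if every vertex carries at most one particle. -/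
def IsStableConfig (η : Config) : Prop := ∀ v : ℤ, η v ≤ 1

/-- The result of executing an instruction at the vertex `x`. It is only ever used at an unstable
vertex, where `2 ≤ η x` and the subtractions are not truncated. -/
noncomputable def topple (η : Config) (x : ℤ) : Instruction → Config
  | Instruction.left => η - Finsupp.single x 1 + Finsupp.single (x - 1) 1
  | Instruction.right => η - Finsupp.single x 1 + Finsupp.single (x + 1) 1
  | Instruction.both => η - Finsupp.single x 2 + Finsupp.single (x - 1) 1 + Finsupp.single (x + 1) 1
  | Instruction.nothing => η

/-- The leftmost unstable vertex. The set is finite, so this is its minimum unless `η` is stable. -/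
noncomputable def leftmostUnstable (η : Config) : ℤ := sInf {v : ℤ | 1 < η v}

open Classical in
/-- One step of the stabilization with stacks `s` (the `i`-th instruction at `x` is `s x i`), acting
on a configuration together with its odometer: if the configuration is unstable, execute at the
leftmost unstable vertex the next unused instruction of its stack; otherwise do nothing. -/
noncomputable def step (s : ℤ → ℕ → Instruction) (c : Config × (ℤ →₀ ℕ)) : Config × (ℤ →₀ ℕ) :=
  if IsStableConfig c.1 then c
  else
    (topple c.1 (leftmostUnstable c.1) (s (leftmostUnstable c.1) (c.2 (leftmostUnstable c.1))),
      c.2 + Finsupp.single (leftmostUnstable c.1) 1)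

/-- Configuration and odometer after `k` steps, starting from `n` particles at the origin and the
zero odometer. -/
noncomputable def process (s : ℤ → ℕ → Instruction) (n k : ℕ) : Config × (ℤ →₀ ℕ) :=
  (step s)^[k] (Finsupp.single 0 n, 0)

/-- The configuration after `k` steps. -/
noncomputable def config (s : ℤ → ℕ → Instruction) (n k : ℕ) : Config := (process s n k).1

/-- The stabilization time: the first `k` at which the configuration is stable (infinite if there
is none). -/
noncomputable def stabTime (s : ℤ → ℕ → Instruction) (n : ℕ) : ℕ∞ :=
  ⨅ (k : ℕ) (_ : IsStableConfig (config s n k)), (k : ℕ∞)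

/-- The final stable configuration (meaningful when the stabilization time is finite). -/
noncomputable def finalConfig (s : ℤ → ℕ → Instruction) (n : ℕ) : Config :=
  config s n (stabTime s n).toNat

/-- The center of mass `∑ x, x * η x`. -/
noncomputable def centerOfMass (η : Config) : ℤ := η.sum fun x m => x * (m : ℤ)

/-- The instructions `ξ x i` are independent random variables, each sending a particle to each of
the two neighbours with probability `p`, independently. -/
structure IsInstructionStack {Ω : Type*} [MeasurableSpace Ω] (P : Measure Ω) (p : ℝ)
    (ξ : ℤ → ℕ → Ω → Instruction) : Prop where
  measurable : ∀ x i, Measurable (ξ x i)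
  indep : iIndepFun (fun a : ℤ × ℕ => ξ a.1 a.2) P
  prob_left : ∀ x i, P.real {ω | ξ x i ω = Instruction.left} = p * (1 - p)
  prob_right : ∀ x i, P.real {ω | ξ x i ω = Instruction.right} = p * (1 - p)
  prob_both : ∀ x i, P.real {ω | ξ x i ω = Instruction.both} = p ^ 2
  prob_nothing : ∀ x i, P.real {ω | ξ x i ω = Instruction.nothing} = (1 - p) ^ 2

end StochasticSandpile

/-! Let `T` be the number of topplings so far, `M` the center of mass and `S` the second moment. A
toppling moves `M` by `±1` with probability `p(1-p)` each, whatever the state, so `M` is a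
martingale whose variance grows by `2p(1-p)` per toppling. A central limit theorem for `M` follows
once `T` is asymptotically deterministic: `T/n³ → 1/(24p)` gives the variance `2p(1-p)/(24p) =
(1-p)/12`.

The law of large numbers for `T` rests on a deterministic invariant (`HasHull.topple`): inside the
hull, every interval carries at least its number of sites minus one particles. Hence a stable
configuration is an interval with at most one hole, and `nS - M² = n⁴/12 + O(n³)`
(`HasHull.abs_variance_sub_le`). The invariant also confines all particles to `[-n, n]`, so `S ≤
n³`. As `N = S - 2pT` is a martingale, `E T = O(n³)`, which yields almost sure termination, `E M² =
O(n³)` and `E N² = O(n⁵)`. Thus `M²/n` and `N` are negligible against `n³`, and `2pT = S - N` is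
close to `n³/12`.

For the limit law, let `φ` be the characteristic function of one displacement. Then `exp(isM)
φ(s)^(-T)` has mean one (`IsInstructionStack.integral_exp_mul_zpow`). With `s = t/n^(3/2)`,
`φ(s)^(-T)` is close to the constant `exp((1-p)t²/24)`, which can be divided out.

All expectations are taken at deterministic times. At the time `horizon p n`, of order `n³`, `T/n³`
is bounded and stabilization has occurred with probability `1 - O(1/n)`, so no optional stopping is
needed. -/

namespace StochasticSandpile

/-! ### Effect of a single toppling -/

/-- The number of particles that an instruction sends to the left. -/
def Instruction.toLeft : Instruction → ℕ
  | left => 1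
  | right => 0
  | both => 1
  | nothing => 0

/-- The number of particles that an instruction sends to the right. -/
def Instruction.toRight : Instruction → ℕ
  | left => 0
  | right => 1
  | both => 1
  | nothing => 0

theorem Instruction.toLeft_le_one (ι : Instruction) : ι.toLeft ≤ 1 := by
  cases ι <;> simp [toLeft]

theorem Instruction.toRight_le_one (ι : Instruction) : ι.toRight ≤ 1 := by
  cases ι <;> simp [toRight]

theorem one_lt_apply_leftmostUnstable {η : Config} (h : ¬ IsStableConfig η) :
    1 < η (leftmostUnstable η) := by
  have hne : {v : ℤ | 1 < η v}.Nonempty := by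
    simpa [IsStableConfig, Set.Nonempty] using h
  have hfin : {v : ℤ | 1 < η v}.Finite := by
    refine η.support.finite_toSet.subset fun v hv => ?_
    replace hv : 1 < η v := hv
    simp only [Finset.mem_coe, Finsupp.mem_support_iff]
    omega
  exact Int.csInf_mem hne hfin.bddBelow

/-- Moving the departing particles to the other side removes truncated subtraction; every additive
functional of a toppled configuration is computed from this identity. -/
theorem topple_add_single {η : Config} {x : ℤ} (hx : 1 < η x) (ι : Instruction) :
    topple η x ι + Finsupp.single x (ι.toLeft + ι.toRight) =
      η + Finsupp.single (x - 1) ι.toLeft + Finsupp.single (x + 1) ι.toRight := by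
  have h1 : Finsupp.single x 1 ≤ η := by
    rw [Finsupp.single_le_iff]; omega
  have h2 : Finsupp.single x 2 ≤ η := by
    rw [Finsupp.single_le_iff]; omega
  cases ι
  · simp only [topple, Instruction.toLeft, Instruction.toRight, add_zero, Finsupp.single_zero]
    rw [add_right_comm, tsub_add_cancel_of_le h1]
  · simp only [topple, Instruction.toLeft, Instruction.toRight, add_zero, zero_add,
      Finsupp.single_zero]
    rw [add_right_comm, tsub_add_cancel_of_le h1]
  · simp only [topple, Instruction.toLeft, Instruction.toRight]
    rw [add_right_comm, add_right_comm _ _ (Finsupp.single x (1 + 1)), tsub_add_cancel_of_le h2]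
  · simp [topple, Instruction.toLeft, Instruction.toRight]

theorem topple_apply {η : Config} {x : ℤ} (hx : 1 < η x) (ι : Instruction) (y : ℤ) :
    (topple η x ι y : ℤ) = η y - (if y = x then (ι.toLeft + ι.toRight : ℤ) else 0) +
      (if y = x - 1 then (ι.toLeft : ℤ) else 0) + (if y = x + 1 then (ι.toRight : ℤ) else 0) := by
  have h := DFunLike.congr_fun (topple_add_single hx ι) y
  simp only [Finsupp.add_apply, Finsupp.single_apply, @eq_comm _ _ y] at h
  split_ifs at h ⊢ <;> omega

/-! ### Additive functionals and interval counts -/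

/-- The sum of the values of `f` at the particles of a configuration. -/
noncomputable def particleSum (f : ℤ → ℤ) (η : ℤ →₀ ℕ) : ℤ := η.sum fun x m => f x * (m : ℤ)

theorem particleSum_add (f : ℤ → ℤ) (η θ : ℤ →₀ ℕ) :
    particleSum f (η + θ) = particleSum f η + particleSum f θ :=
  Finsupp.sum_add_index' (by simp) (by intros; push_cast; ring)

theorem particleSum_single (f : ℤ → ℤ) (x : ℤ) (m : ℕ) :
    particleSum f (Finsupp.single x m) = f x * m :=
  Finsupp.sum_single_index (by simp)

theorem particleSum_zero (f : ℤ → ℤ) : particleSum f 0 = 0 := Finsupp.sum_zero_index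

theorem particleSum_topple (f : ℤ → ℤ) {η : Config} {x : ℤ} (hx : 1 < η x) (ι : Instruction) :
    particleSum f (topple η x ι) = particleSum f η +
      ι.toLeft * (f (x - 1) - f x) + ι.toRight * (f (x + 1) - f x) := by
  have h := congrArg (particleSum f) (topple_add_single hx ι)
  simp only [particleSum_add, particleSum_single] at h
  push_cast at h
  linarith

theorem particleSum_eq_sum (f : ℤ → ℤ) {η : ℤ →₀ ℕ} {s : Finset ℤ} (h : ∀ x ∉ s, η x = 0) :
    particleSum f η = ∑ x ∈ s, f x * (η x : ℤ) := by
  refine Finsupp.sum_of_support_subset _ (fun x hx => ?_) _ (by simp)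
  by_contra hxs
  exact (Finsupp.mem_support_iff.mp hx) (h x hxs)

/-- The number of particles in an interval. -/
noncomputable def count (η : Config) (i j : ℤ) : ℤ := ∑ y ∈ Finset.Icc i j, (η y : ℤ)

theorem count_nonneg (η : Config) (i j : ℤ) : 0 ≤ count η i j :=
  Finset.sum_nonneg fun _ _ => by positivity

theorem count_split (η : Config) {i x j : ℤ} (hi : i ≤ x) (hj : x ≤ j) :
    count η i j = count η i (x - 1) + η x + count η (x + 1) j := by
  have : Finset.Icc i j = insert x (Finset.Icc i (x - 1) ∪ Finset.Icc (x + 1) j) := by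
    ext y; simp only [Finset.mem_Icc, Finset.mem_insert, Finset.mem_union]; omega
  rw [count, this, Finset.sum_insert (by simp), Finset.sum_union, count, count]
  · ring
  · rw [Finset.disjoint_left]; intro y; simp only [Finset.mem_Icc]; omega

theorem count_topple {η : Config} {x : ℤ} (hx : 1 < η x) (ι : Instruction) (i j : ℤ) :
    count (topple η x ι) i j = count η i j -
      (if i ≤ x ∧ x ≤ j then (ι.toLeft + ι.toRight : ℤ) else 0) +
      (if i ≤ x - 1 ∧ x - 1 ≤ j then (ι.toLeft : ℤ) else 0) +
      (if i ≤ x + 1 ∧ x + 1 ≤ j then (ι.toRight : ℤ) else 0) := by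
  simp only [count, topple_apply hx, Finset.sum_add_distrib, Finset.sum_sub_distrib,
    Finset.sum_ite_eq', Finset.mem_Icc]

/-! ### The hull invariant -/

/-- The configuration occupies the endpoints of `[a, b] ∋ 0`, is supported there, and every
subinterval of `[a, b]` carries at least its length minus one particles. -/
structure HasHull (η : Config) (a b : ℤ) : Prop where
  left_nonpos : a ≤ 0
  right_nonneg : 0 ≤ b
  eq_zero_of_lt : ∀ y < a, η y = 0
  eq_zero_of_gt : ∀ y, b < y → η y = 0
  left_pos : 0 < η a
  right_pos : 0 < η b
  le_count : ∀ i j, a ≤ i → i ≤ j → j ≤ b → j - i ≤ count η i j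

/-- An interval avoiding `x` only gains particles. For one containing `x`, the bounds on the two
sides of `x` and `η x ≥ 2` add up to enough: particles leave only across an end located at `x`, and
there the empty side contributes a spare unit. -/
theorem HasHull.topple {η : Config} {a b x : ℤ} (h : HasHull η a b) (hx : 1 < η x)
    (ι : Instruction) : ∃ a' b', HasHull (topple η x ι) a' b' := by
  have hL := ι.toLeft_le_one
  have hR := ι.toRight_le_one
  obtain ⟨ha, hb, hlt, hgt, hla, hrb, hc⟩ := h
  have hax : a ≤ x := by
    by_contra hlt'
    have := hlt x (by omega)
    omega
  have hxb : x ≤ b := by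
    by_contra hlt'
    have := hgt x (by omega)
    omega
  -- The hull grows only when an endpoint itself sends a particle outwards. Otherwise a toppled
  -- endpoint loses at most one of its two or more particles, except when it is both endpoints'
  -- neighbour-sending side, which is the growing case.
  obtain ⟨a', ha'⟩ : ∃ a', a' = if x = a ∧ ι.toLeft = 1 then a - 1 else a := ⟨_, rfl⟩
  obtain ⟨b', hb'⟩ : ∃ b', b' = if x = b ∧ ι.toRight = 1 then b + 1 else b := ⟨_, rfl⟩
  refine ⟨a', b', by split_ifs at ha' <;> omega, by split_ifs at hb' <;> omega, ?_, ?_, ?_, ?_, ?_⟩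
  · intro y hy
    have h1 := topple_apply hx ι y
    have h2 := hlt y (by split_ifs at ha' <;> omega)
    split_ifs at h1 ha' <;> omega
  · intro y hy
    have h1 := topple_apply hx ι y
    have h2 := hgt y (by split_ifs at hb' <;> omega)
    split_ifs at h1 hb' <;> omega
  · have h1 := topple_apply hx ι a'
    split_ifs at ha' <;> subst ha' <;> split_ifs at h1 <;> grind
  · have h1 := topple_apply hx ι b'
    split_ifs at hb' <;> subst hb' <;> split_ifs at h1 <;> grind
  · intro i j hi hij hj
    rw [count_topple hx]
    have hn := count_nonneg η i j
    by_cases hxi : i ≤ x ∧ x ≤ j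
    · have hs := count_split η hxi.1 hxi.2
      have h1 := count_nonneg η i (x - 1)
      have h2 := count_nonneg η (x + 1) j
      -- Outside the invariant's range, either `i = x` and the left side is `-1`, or `i = a - 1`
      -- with `x = a` and it is `0`.
      have h3 : x - 1 - i ≤ count η i (x - 1) := by
        by_cases hai : a ≤ i ∧ i ≤ x - 1
        · exact hc _ _ hai.1 hai.2 (by omega)
        · split_ifs at ha' <;> omega
      have h4 : j - (x + 1) ≤ count η (x + 1) j := by
        by_cases hai : j ≤ b ∧ x + 1 ≤ j
        · exact hc _ _ (by omega) hai.2 hai.1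
        · split_ifs at hb' <;> omega
      split_ifs <;> omega
    · have h3 : j - i ≤ count η i j := by
        by_cases hai : a ≤ i ∧ j ≤ b
        · exact hc _ _ hai.1 hij hai.2
        · split_ifs at ha' hb' <;> omega
      split_ifs <;> omega

theorem hasHull_single {n : ℕ} (hn : 0 < n) : HasHull (Finsupp.single 0 n) 0 0 where
  left_nonpos := le_rfl
  right_nonneg := le_rfl
  eq_zero_of_lt y hy := by simp [hy.ne']
  eq_zero_of_gt y hy := by simp [hy.ne]
  left_pos := by simpa
  right_pos := by simpa
  le_count i j hi hij hj := by
    obtain rfl : i = j := by omega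
    simpa using count_nonneg _ i i

/-! ### Deterministic properties of visited states -/

/-- The successor of an unstable state when the instruction `ι` is executed. -/
noncomputable def execute (c : Config × (ℤ →₀ ℕ)) (ι : Instruction) : Config × (ℤ →₀ ℕ) :=
  (topple c.1 (leftmostUnstable c.1) ι, c.2 + Finsupp.single (leftmostUnstable c.1) 1)

/-- The next instruction that the stacks `s` provide in a state. -/
noncomputable def nextInstruction (s : ℤ → ℕ → Instruction) (c : Config × (ℤ →₀ ℕ)) :
    Instruction := s (leftmostUnstable c.1) (c.2 (leftmostUnstable c.1))

theorem step_of_stable (s : ℤ → ℕ → Instruction) {c : Config × (ℤ →₀ ℕ)}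
    (h : IsStableConfig c.1) : step s c = c := by simp [step, h]

theorem step_of_not_stable (s : ℤ → ℕ → Instruction) {c : Config × (ℤ →₀ ℕ)}
    (h : ¬ IsStableConfig c.1) : step s c = execute c (nextInstruction s c) := by
  simp [step, h, execute, nextInstruction]

theorem process_zero (s : ℤ → ℕ → Instruction) (n : ℕ) :
    process s n 0 = (Finsupp.single 0 n, 0) := rfl

theorem process_succ (s : ℤ → ℕ → Instruction) (n k : ℕ) :
    process s n (k + 1) = step s (process s n k) := Function.iterate_succ_apply' _ _ _

/-- The number of topplings recorded in a state. -/
noncomputable def topplings (c : Config × (ℤ →₀ ℕ)) : ℤ := particleSum (fun _ => 1) c.2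

/-- The second moment of a configuration about the origin. -/
noncomputable def secondMoment (η : Config) : ℤ := particleSum (fun x => x ^ 2) η

theorem topplings_execute (c : Config × (ℤ →₀ ℕ)) (ι : Instruction) :
    topplings (execute c ι) = topplings c + 1 := by
  simp [topplings, execute, particleSum_add, particleSum_single]

theorem centerOfMass_eq_particleSum (η : Config) : centerOfMass η = particleSum (fun x => x) η :=
  rfl

theorem centerOfMass_execute {c : Config × (ℤ →₀ ℕ)} (h : ¬ IsStableConfig c.1)
    (ι : Instruction) :
    centerOfMass (execute c ι).1 = centerOfMass c.1 - ι.toLeft + ι.toRight := by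
  simp only [centerOfMass_eq_particleSum, execute]
  rw [particleSum_topple _ (one_lt_apply_leftmostUnstable h)]
  ring

theorem secondMoment_execute {c : Config × (ℤ →₀ ℕ)} (h : ¬ IsStableConfig c.1)
    (ι : Instruction) :
    secondMoment (execute c ι).1 = secondMoment c.1 +
      ι.toLeft * (1 - 2 * leftmostUnstable c.1) + ι.toRight * (1 + 2 * leftmostUnstable c.1) := by
  simp only [secondMoment, execute]
  rw [particleSum_topple _ (one_lt_apply_leftmostUnstable h)]
  ring

theorem topplings_nonneg (c : Config × (ℤ →₀ ℕ)) : 0 ≤ topplings c :=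
  Finset.sum_nonneg fun _ _ => by positivity

/-- Induction over the states that the stabilization visits. -/
theorem process_induction {n : ℕ} {C : ℕ → Config × (ℤ →₀ ℕ) → Prop}
    (zero : C 0 (Finsupp.single 0 n, 0))
    (stable : ∀ k c, IsStableConfig c.1 → C k c → C (k + 1) c)
    (unstable : ∀ k c ι, ¬ IsStableConfig c.1 → C k c → C (k + 1) (execute c ι))
    (s : ℤ → ℕ → Instruction) (k : ℕ) : C k (process s n k) := by
  induction k with
  | zero => exact zero
  | succ k ih =>
    rw [process_succ]
    by_cases h : IsStableConfig (process s n k).1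
    · rw [step_of_stable s h]; exact stable k _ h ih
    · rw [step_of_not_stable s h]; exact unstable k _ _ h ih

theorem particleSum_one_process (s : ℤ → ℕ → Instruction) (n k : ℕ) :
    particleSum (fun _ => 1) (process s n k).1 = n := by
  refine process_induction (C := fun _ c => particleSum (fun _ => 1) c.1 = n) ?_ ?_ ?_ s k
  · simp [particleSum_single]
  · exact fun _ _ _ h => h
  · intro k c ι hc h
    rw [execute, particleSum_topple _ (one_lt_apply_leftmostUnstable hc), h]
    simp

theorem exists_hasHull_process (s : ℤ → ℕ → Instruction) {n : ℕ} (hn : 0 < n) (k : ℕ) :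
    ∃ a b, HasHull (process s n k).1 a b := by
  refine process_induction (C := fun _ c => ∃ a b, HasHull c.1 a b) ?_ ?_ ?_ s k
  · exact ⟨0, 0, hasHull_single hn⟩
  · exact fun _ _ _ h => h
  · rintro k c ι hc ⟨a, b, h⟩
    exact h.topple (one_lt_apply_leftmostUnstable hc) ι

theorem topplings_process_le (s : ℤ → ℕ → Instruction) (n k : ℕ) :
    topplings (process s n k) ≤ k := by
  refine process_induction (C := fun k c => topplings c ≤ k) ?_ ?_ ?_ s k
  · simp [topplings, particleSum_zero]
  · intro k c _ h; push_cast; omega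
  · intro k c ι _ h; rw [topplings_execute]; push_cast; omega

theorem topplings_process_of_not_stable {s : ℤ → ℕ → Instruction} {n k : ℕ}
    (h : ¬ IsStableConfig (process s n k).1) : topplings (process s n k) = k := by
  refine process_induction (C := fun k c => ¬ IsStableConfig c.1 → topplings c = k) ?_ ?_ ?_ s k h
  · simp [topplings, particleSum_zero]
  · intro k c h1 _ h2; exact absurd h1 h2
  · intro k c ι h1 h _; rw [topplings_execute, h h1]; push_cast; rfl

theorem process_of_stable {s : ℤ → ℕ → Instruction} {n k l : ℕ}
    (h : IsStableConfig (process s n k).1) (hkl : k ≤ l) : process s n l = process s n k := by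
  induction l, hkl using Nat.le_induction with
  | base => rfl
  | succ l _ ih => rw [process_succ, ih, step_of_stable s h]

theorem HasHull.eq_zero {η : Config} {a b : ℤ} (h : HasHull η a b) :
    ∀ x ∉ Finset.Icc a b, η x = 0 := by
  intro x hx
  rw [Finset.mem_Icc] at hx
  by_cases hxa : x < a
  · exact h.eq_zero_of_lt x hxa
  · exact h.eq_zero_of_gt x (by omega)

theorem HasHull.particleSum_eq {η : Config} {a b : ℤ} (h : HasHull η a b) (f : ℤ → ℤ) :
    particleSum f η = ∑ x ∈ Finset.Icc a b, f x * (η x : ℤ) :=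
  particleSum_eq_sum f h.eq_zero

theorem HasHull.sub_le {η : Config} {a b : ℤ} (h : HasHull η a b) :
    b - a ≤ particleSum (fun _ => 1) η := by
  have := h.le_count a b le_rfl (h.left_nonpos.trans h.right_nonneg) le_rfl
  rw [h.particleSum_eq]
  simpa [count] using this

theorem HasHull.abs_le {η : Config} {a b x : ℤ} (h : HasHull η a b) (hx : η x ≠ 0) :
    |x| ≤ particleSum (fun _ => 1) η := by
  have hm : x ∈ Finset.Icc a b := by
    by_contra hx'
    exact hx (h.eq_zero x hx')
  have := h.sub_le
  have := h.left_nonpos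
  have := h.right_nonneg
  rw [Finset.mem_Icc] at hm
  rw [_root_.abs_le]
  constructor <;> omega

theorem abs_le_of_process_ne_zero {s : ℤ → ℕ → Instruction} {n k : ℕ} (hn : 0 < n) {x : ℤ}
    (hx : (process s n k).1 x ≠ 0) : |x| ≤ n := by
  obtain ⟨a, b, h⟩ := exists_hasHull_process s hn k
  exact (h.abs_le hx).trans_eq (particleSum_one_process s n k)

theorem abs_leftmostUnstable_process_le {s : ℤ → ℕ → Instruction} {n k : ℕ} (hn : 0 < n)
    (h : ¬ IsStableConfig (process s n k).1) : |leftmostUnstable (process s n k).1| ≤ n :=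
  abs_le_of_process_ne_zero hn (zero_lt_one.trans (one_lt_apply_leftmostUnstable h)).ne'

/-- The hull contains the origin and has length at most `n`, so each of the `n` particles
contributes at most `n²`. This ceiling is what bounds the number of topplings in mean. -/
theorem secondMoment_process_le (s : ℤ → ℕ → Instruction) {n : ℕ} (hn : 0 < n) (k : ℕ) :
    secondMoment (process s n k).1 ≤ n ^ 3 := by
  have h1 := particleSum_one_process s n k
  have : secondMoment (process s n k).1 ≤
      n ^ 2 * particleSum (fun _ => 1) (process s n k).1 := by
    rw [secondMoment, particleSum, particleSum, Finsupp.sum, Finsupp.sum, Finset.mul_sum]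
    refine Finset.sum_le_sum fun x hx => ?_
    have := abs_le_of_process_ne_zero hn (Finsupp.mem_support_iff.mp hx)
    have h2 : x ^ 2 ≤ (n : ℤ) ^ 2 := sq_le_sq' (by linarith [neg_abs_le x]) (by linarith [le_abs_self x])
    have : (0 : ℤ) ≤ (process s n k).1 x := by positivity
    nlinarith
  rw [h1] at this
  linarith [this]

/-! ### Variance of a stable configuration -/

theorem sum_Icc_sub (a : ℤ) (d : ℕ) :
    ∑ x ∈ Finset.Icc a (a + d), 2 * (x - a) = (d : ℤ) * (d + 1) := by
  induction d with
  | zero => simp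
  | succ d ih =>
    have : Finset.Icc a (a + (d + 1 : ℕ)) = insert (a + d + 1) (Finset.Icc a (a + d)) := by
      ext y; simp only [Finset.mem_Icc, Finset.mem_insert]; push_cast; omega
    rw [this, Finset.sum_insert (by simp), ih]
    push_cast
    ring

theorem sum_Icc_sub_sq (a : ℤ) (d : ℕ) :
    ∑ x ∈ Finset.Icc a (a + d), 6 * (x - a) ^ 2 = (d : ℤ) * (d + 1) * (2 * d + 1) := by
  induction d with
  | zero => simp
  | succ d ih =>
    have : Finset.Icc a (a + (d + 1 : ℕ)) = insert (a + d + 1) (Finset.Icc a (a + d)) := by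
      ext y; simp only [Finset.mem_Icc, Finset.mem_insert]; push_cast; omega
    rw [this, Finset.sum_insert (by simp), ih]
    push_cast
    ring

/-- A stable configuration with a hull is an interval with at most one hole, so that its variance
is that of an interval up to lower order terms. -/
theorem HasHull.abs_variance_sub_le {η : Config} {a b : ℤ} (h : HasHull η a b)
    (hs : IsStableConfig η) {n : ℕ} (hn : 0 < n) (hmass : particleSum (fun _ => 1) η = n) :
    |12 * (n * secondMoment η - centerOfMass η ^ 2) - (n : ℤ) ^ 4| ≤ 13 * (n : ℤ) ^ 3 := by
  have hsub := h.sub_le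
  have hab := h.left_nonpos.trans h.right_nonneg
  obtain ⟨d, rfl⟩ : ∃ d : ℕ, b = a + d := ⟨(b - a).toNat, by omega⟩
  have hη : ∀ x, (η x : ℤ) ≤ 1 := fun x => by exact_mod_cast hs x
  have hM := h.particleSum_eq (fun x => x)
  have hS := h.particleSum_eq (fun x => x ^ 2)
  rw [← centerOfMass_eq_particleSum] at hM
  rw [← secondMoment] at hS
  have h0 := h.particleSum_eq (fun _ => 1)
  rw [hmass] at h0 hsub
  set I := Finset.Icc a (a + (d : ℤ)) with hI
  have hI1 : ∑ x ∈ I, (1 : ℤ) = d + 1 := by simp [hI]; omega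
  have hI2 := sum_Icc_sub a d
  have hI3 := sum_Icc_sub_sq a d
  rw [← hI] at hI2 hI3
  have hM' : ∑ x ∈ I, (x - a) * (η x : ℤ) = centerOfMass η - a * n := by
    rw [hM, h0, Finset.mul_sum, ← Finset.sum_sub_distrib]
    exact Finset.sum_congr rfl fun _ _ => by ring
  have hS' : ∑ x ∈ I, (x - a) ^ 2 * (η x : ℤ) =
      secondMoment η - 2 * a * centerOfMass η + a ^ 2 * n := by
    rw [hS, hM, h0, Finset.mul_sum, Finset.mul_sum, ← Finset.sum_sub_distrib,
      ← Finset.sum_add_distrib]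
    exact Finset.sum_congr rfl fun _ _ => by ring
  have hhole : ∑ x ∈ I, (1 - (η x : ℤ)) = d + 1 - n := by
    rw [Finset.sum_sub_distrib, hI1, h0]; simp
  have hnonneg : 0 ≤ ∑ x ∈ I, (1 - (η x : ℤ)) :=
    Finset.sum_nonneg fun x _ => by linarith [hη x]
  have hmem : ∀ x ∈ I, 0 ≤ x - a ∧ x - a ≤ d := fun x hx => by
    rw [hI, Finset.mem_Icc] at hx; omega
  have hMu : ∑ x ∈ I, (x - a) * (η x : ℤ) ≤ ∑ x ∈ I, (x - a) :=
    Finset.sum_le_sum fun x hx => by nlinarith [hmem x hx, hη x]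
  have hMl : ∑ x ∈ I, (x - a) - d * (d + 1 - n) ≤ ∑ x ∈ I, (x - a) * (η x : ℤ) := by
    rw [← hhole, Finset.mul_sum, ← Finset.sum_sub_distrib]
    exact Finset.sum_le_sum fun x hx => by nlinarith [hmem x hx, hη x]
  have hSu : ∑ x ∈ I, (x - a) ^ 2 * (η x : ℤ) ≤ ∑ x ∈ I, (x - a) ^ 2 :=
    Finset.sum_le_sum fun x hx => by nlinarith [sq_nonneg (x - a), hη x]
  have hSl : ∑ x ∈ I, (x - a) ^ 2 - d ^ 2 * (d + 1 - n) ≤ ∑ x ∈ I, (x - a) ^ 2 * (η x : ℤ) := by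
    rw [← hhole, Finset.mul_sum, ← Finset.sum_sub_distrib]
    refine Finset.sum_le_sum fun x hx => ?_
    have : (x - a) ^ 2 ≤ (d : ℤ) ^ 2 := pow_le_pow_left₀ (hmem x hx).1 (hmem x hx).2 2
    nlinarith [hη x]
  rw [← Finset.mul_sum] at hI2 hI3
  rw [hM'] at hMu hMl
  rw [hS'] at hSu hSl
  -- The variance is translation invariant, so positions may be measured from `a`.
  have hvar : n * secondMoment η - centerOfMass η ^ 2 =
      n * (secondMoment η - 2 * a * centerOfMass η + a ^ 2 * n) -
        (centerOfMass η - a * n) ^ 2 := by ring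
  rw [hvar]
  generalize secondMoment η - 2 * a * centerOfMass η + a ^ 2 * n = S at *
  generalize centerOfMass η - a * n = M at *
  generalize ∑ x ∈ I, (x - a) ^ 2 = Q at *
  generalize ∑ x ∈ I, (x - a) = R at *
  have hn1 : (1 : ℤ) ≤ n := by exact_mod_cast hn
  -- The hull gives `d ≤ n` and stability gives `n ≤ d + 1`: no hole or exactly one. Without a hole
  -- the variance is explicit; a hole changes the first moment by at most `n` and the second by at
  -- most `n²`.
  obtain hd | hd : (d : ℤ) = n - 1 ∨ (d : ℤ) = n := by omega
  · rw [hd] at hI2 hI3 hMl hSl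
    have h2M : 2 * M = (n - 1) * n := by linarith
    have h6S : 6 * S = (n - 1) * n * (2 * n - 1) := by linarith
    have : 12 * (n * S - M ^ 2) - (n : ℤ) ^ 4 = - n ^ 2 := by
      linear_combination 2 * (n : ℤ) * h6S - 3 * (2 * M + (n - 1) * n) * h2M
    rw [this, abs_neg, _root_.abs_of_nonneg (by positivity)]
    nlinarith [pow_pos (zero_lt_one.trans_le hn1) 2, pow_pos (zero_lt_one.trans_le hn1) 3]
  · rw [hd] at hI2 hI3 hMl hSl
    have h1 : (n : ℤ) * (n - 1) ≤ 2 * M := by linarith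
    have h2 : 2 * M ≤ n * (n + 1) := by linarith
    have h3 : (n : ℤ) * (n + 1) * (2 * n + 1) - 6 * n ^ 2 ≤ 6 * S := by linarith
    have h4 : 6 * S ≤ n * (n + 1) * (2 * n + 1) := by linarith
    have h5 : ((n : ℤ) * (n - 1)) ^ 2 ≤ (2 * M) ^ 2 :=
      pow_le_pow_left₀ (mul_nonneg (by omega) (by omega)) h1 2
    have h6 : (2 * M) ^ 2 ≤ ((n : ℤ) * (n + 1)) ^ 2 :=
      pow_le_pow_left₀ ((mul_nonneg (by omega) (by omega)).trans h1) h2 2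
    have h7 := mul_le_mul_of_nonneg_left h3 (by omega : (0 : ℤ) ≤ n)
    have h8 := mul_le_mul_of_nonneg_left h4 (by omega : (0 : ℤ) ≤ n)
    have h9 : (n : ℤ) ^ 2 ≤ n ^ 3 := pow_le_pow_right₀ hn1 (by norm_num)
    have h10 : (0 : ℤ) ≤ (n : ℤ) ^ 2 := by positivity
    rw [_root_.abs_le]
    constructor <;> nlinarith

/-! ### Markov property of configuration and odometer -/

/-- A state depends only on the instructions that its odometer records as used. -/
theorem process_congr {s s' : ℤ → ℕ → Instruction} {n k : ℕ}
    (h : ∀ y, ∀ i < (process s n k).2 y, s y i = s' y i) : process s' n k = process s n k := by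
  induction k with
  | zero => rfl
  | succ k ih =>
    rw [process_succ] at h
    by_cases hst : IsStableConfig (process s n k).1
    · rw [step_of_stable s hst] at h
      rw [process_succ, process_succ, ih h, step_of_stable _ hst, step_of_stable _ hst]
    · rw [step_of_not_stable s hst] at h
      have h' := ih fun y i hi => h y i (hi.trans_le (by simp [execute]))
      rw [process_succ, process_succ, h', step_of_not_stable _ hst, step_of_not_stable _ hst,
        nextInstruction, nextInstruction, h _ _ (by simp [execute])]

/-- The probability of an instruction. -/
def instructionProb (p : ℝ) : Instruction → ℝ
  | Instruction.left => p * (1 - p)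
  | Instruction.right => p * (1 - p)
  | Instruction.both => p ^ 2
  | Instruction.nothing => (1 - p) ^ 2

/-- All instructions. -/
def instructions : Finset Instruction :=
  ⟨{Instruction.left, Instruction.right, Instruction.both, Instruction.nothing}, by simp⟩

theorem mem_instructions (ι : Instruction) : ι ∈ instructions := by
  cases ι <;> simp [instructions]

theorem sum_instructions {E : Type*} [AddCommMonoid E] (f : Instruction → E) :
    ∑ ι ∈ instructions, f ι = f Instruction.left + (f Instruction.right +
      (f Instruction.both + f Instruction.nothing)) := by
  simp [instructions, Finset.sum]

instance instFiniteInstruction : Finite Instruction :=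
  Finite.of_surjective (fun ι : instructions => (ι : Instruction))
    fun ι => ⟨⟨ι, mem_instructions ι⟩, rfl⟩

open Classical in
/-- The transition operator of the chain of configurations and odometers. -/
noncomputable def transition {E : Type*} [AddCommGroup E] [Module ℝ E] (p : ℝ)
    (F : Config × (ℤ →₀ ℕ) → E) (c : Config × (ℤ →₀ ℕ)) : E :=
  if IsStableConfig c.1 then F c
  else ∑ ι ∈ instructions, instructionProb p ι • F (execute c ι)

theorem transition_of_stable {E : Type*} [AddCommGroup E] [Module ℝ E] (p : ℝ)
    (F : Config × (ℤ →₀ ℕ) → E) {c : Config × (ℤ →₀ ℕ)} (h : IsStableConfig c.1) :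
    transition p F c = F c := if_pos h

theorem transition_of_not_stable {E : Type*} [AddCommGroup E] [Module ℝ E] (p : ℝ)
    (F : Config × (ℤ →₀ ℕ) → E) {c : Config × (ℤ →₀ ℕ)} (h : ¬ IsStableConfig c.1) :
    transition p F c = ∑ ι ∈ instructions, instructionProb p ι • F (execute c ι) := if_neg h

theorem finite_range_process (n k : ℕ) : (Set.range fun s => process s n k).Finite := by
  induction k with
  | zero => exact (Set.finite_singleton (Finsupp.single 0 n, 0)).subset (by rintro _ ⟨s, rfl⟩; rfl)
  | succ k ih =>
    refine (ih.union (Set.Finite.image2 execute ih (Set.toFinite Set.univ))).subset ?_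
    rintro _ ⟨s, rfl⟩
    simp only [process_succ]
    by_cases h : IsStableConfig (process s n k).1
    · rw [step_of_stable s h]; exact Or.inl ⟨s, rfl⟩
    · rw [step_of_not_stable s h]; exact Or.inr ⟨_, ⟨s, rfl⟩, _, trivial, rfl⟩

/-- The states that can be visited at time `k`. -/
noncomputable def reachable (n k : ℕ) : Finset (Config × (ℤ →₀ ℕ)) :=
  (finite_range_process n k).toFinset

theorem process_mem_reachable (s : ℤ → ℕ → Instruction) (n k : ℕ) :
    process s n k ∈ reachable n k := by simp [reachable]

/-- The instructions used by an odometer. -/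
noncomputable def usedInstructions (u : ℤ →₀ ℕ) : Finset (ℤ × ℕ) :=
  u.support.biUnion fun y => (Finset.range (u y)).image fun i => (y, i)

theorem mem_usedInstructions {u : ℤ →₀ ℕ} {y : ℤ} {i : ℕ} :
    (y, i) ∈ usedInstructions u ↔ i < u y := by
  simp only [usedInstructions, Finset.mem_biUnion, Finsupp.mem_support_iff, Finset.mem_image,
    Finset.mem_range, Prod.mk.injEq]
  constructor
  · rintro ⟨a, _, b, hb, rfl, rfl⟩; exact hb
  · intro h; exact ⟨y, by omega, i, h, rfl, rfl⟩

theorem exists_process_eq_preimage {Ω : Type*} (ξ : ℤ → ℕ → Ω → Instruction) (n k : ℕ)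
    (c : Config × (ℤ →₀ ℕ)) : ∃ A : Set (usedInstructions c.2 → Instruction),
      {ω | process (fun x i => ξ x i ω) n k = c} =
        (fun ω (q : usedInstructions c.2) => ξ q.1.1 q.1.2 ω) ⁻¹' A := by
  -- The image of the event serves as `A`: by `process_congr`, outcomes agreeing on the instructions
  -- used by `c` reach `c` together.
  refine ⟨(fun ω (q : usedInstructions c.2) => ξ q.1.1 q.1.2 ω) ''
    {ω | process (fun x i => ξ x i ω) n k = c}, ?_⟩
  refine (Set.subset_preimage_image _ _).antisymm ?_
  rintro ω ⟨ω', hω', h⟩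
  change process _ n k = c at hω'
  change process _ n k = c
  rw [← hω']
  refine process_congr fun y i hi => ?_
  rw [hω'] at hi
  exact congrFun h ⟨(y, i), mem_usedInstructions.mpr hi⟩

theorem apply_process_eq_sum {Ω E : Type*} [AddCommMonoid E] (F : Config × (ℤ →₀ ℕ) → E)
    (s : Ω → ℤ → ℕ → Instruction) (n k : ℕ) (ω : Ω) : F (process (s ω) n k) = ∑ c ∈ reachable n k,
      Set.indicator {ω | process (s ω) n k = c} (fun _ => F c) ω := by
  rw [Finset.sum_eq_single_of_mem _ (process_mem_reachable (s ω) n k)]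
  · simp
  · intro c _ hc
    exact Set.indicator_of_notMem (fun h => hc h.symm) _

section
variable {Ω : Type*} [MeasurableSpace Ω] {P : Measure Ω} {p : ℝ}
  {ξ : ℤ → ℕ → Ω → Instruction}

theorem IsInstructionStack.measureReal_eq (hξ : IsInstructionStack P p ξ) (x : ℤ) (i : ℕ)
    (ι : Instruction) : P.real {ω | ξ x i ω = ι} = instructionProb p ι := by
  cases ι
  · exact hξ.prob_left x i
  · exact hξ.prob_right x i
  · exact hξ.prob_both x i
  · exact hξ.prob_nothing x i

theorem IsInstructionStack.measurableSet_process_eq (hξ : IsInstructionStack P p ξ) (n k : ℕ)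
    (c : Config × (ℤ →₀ ℕ)) : MeasurableSet {ω | process (fun x i => ξ x i ω) n k = c} := by
  obtain ⟨A, hA⟩ := exists_process_eq_preimage ξ n k c
  rw [hA]
  exact measurable_pi_lambda _ (fun q => hξ.measurable q.1.1 q.1.2) (Set.toFinite A).measurableSet

/-- The next instruction is independent of the past. -/
theorem IsInstructionStack.measureReal_inter (hξ : IsInstructionStack P p ξ) (n k : ℕ)
    (c : Config × (ℤ →₀ ℕ)) (ι : Instruction) :
    P.real ({ω | process (fun x i => ξ x i ω) n k = c} ∩
        {ω | nextInstruction (fun x i => ξ x i ω) c = ι}) =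
      P.real {ω | process (fun x i => ξ x i ω) n k = c} * instructionProb p ι := by
  obtain ⟨A, hA⟩ := exists_process_eq_preimage ξ n k c
  obtain ⟨a, ha⟩ : ∃ a, a = (leftmostUnstable c.1, c.2 (leftmostUnstable c.1)) := ⟨_, rfl⟩
  -- The odometer counts from zero, so the next index is the first unused one.
  have hdisj : Disjoint (usedInstructions c.2) {a} := by
    rw [Finset.disjoint_singleton_right, ha, mem_usedInstructions]; simp
  have hind := hξ.indep.indepFun_finset _ _ hdisj fun q => hξ.measurable q.1 q.2
  have hB : {ω | nextInstruction (fun x i => ξ x i ω) c = ι} =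
      (fun ω (q : ({a} : Finset (ℤ × ℕ))) => ξ q.1.1 q.1.2 ω) ⁻¹'
        {g | g ⟨a, Finset.mem_singleton_self a⟩ = ι} := by
    ext ω; simp [nextInstruction, ha]
  rw [← hξ.measureReal_eq (leftmostUnstable c.1) (c.2 (leftmostUnstable c.1)) ι]
  change _ = _ * P.real {ω | nextInstruction (fun x i => ξ x i ω) c = ι}
  rw [hA, hB]
  simp only [Measure.real]
  rw [hind.measure_inter_preimage_eq_mul _ _ (Set.toFinite _).measurableSet
    (Set.toFinite _).measurableSet, ENNReal.toReal_mul]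

theorem IsInstructionStack.measurable_process (hξ : IsInstructionStack P p ξ) (n k : ℕ)
    (F : Config × (ℤ →₀ ℕ) → ℝ) :
    Measurable (fun ω => F (process (fun x i => ξ x i ω) n k)) := by
  simp only [apply_process_eq_sum F (fun ω x i => ξ x i ω)]
  exact Finset.measurable_fun_sum _ fun c _ =>
    measurable_const.indicator (hξ.measurableSet_process_eq n k c)

theorem IsInstructionStack.measurableSet_not_stable (hξ : IsInstructionStack P p ξ) (n k : ℕ) :
    MeasurableSet {ω | ¬ IsStableConfig (process (fun x i => ξ x i ω) n k).1} := by
  classical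
  have h := hξ.measurable_process n k fun c => if IsStableConfig c.1 then 0 else 1
  convert h (measurableSet_singleton (1 : ℝ)) using 1
  ext ω
  simp

variable [IsProbabilityMeasure P] {E : Type*} [NormedAddCommGroup E]

theorem IsInstructionStack.integrable_process (hξ : IsInstructionStack P p ξ) (n k : ℕ)
    (F : Config × (ℤ →₀ ℕ) → E) :
    Integrable (fun ω => F (process (fun x i => ξ x i ω) n k)) P := by
  simp only [apply_process_eq_sum F (fun ω x i => ξ x i ω)]
  exact integrable_finsetSum _ fun c _ =>
    (integrable_const _).indicator (hξ.measurableSet_process_eq n k c)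

variable [NormedSpace ℝ E]

theorem IsInstructionStack.integral_process [CompleteSpace E] (hξ : IsInstructionStack P p ξ)
    (n k : ℕ) (F : Config × (ℤ →₀ ℕ) → E) :
    ∫ ω, F (process (fun x i => ξ x i ω) n k) ∂P = ∑ c ∈ reachable n k,
      P.real {ω | process (fun x i => ξ x i ω) n k = c} • F c := by
  simp only [apply_process_eq_sum F (fun ω x i => ξ x i ω)]
  rw [integral_finsetSum _ fun c _ =>
    (integrable_const _).indicator (hξ.measurableSet_process_eq n k c)]
  exact Finset.sum_congr rfl fun c _ =>
    integral_indicator_const _ (hξ.measurableSet_process_eq n k c)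

open Classical in
/-- Configurations and odometers form a Markov chain. -/
theorem IsInstructionStack.integral_process_succ [CompleteSpace E]
    (hξ : IsInstructionStack P p ξ) (n k : ℕ) (F : Config × (ℤ →₀ ℕ) → E) :
    ∫ ω, F (process (fun x i => ξ x i ω) n (k + 1)) ∂P =
      ∫ ω, transition p F (process (fun x i => ξ x i ω) n k) ∂P := by
  have hmeas : ∀ c ι, MeasurableSet ({ω | process (fun x i => ξ x i ω) n k = c} ∩
      {ω | nextInstruction (fun x i => ξ x i ω) c = ι}) := fun c ι =>
    (hξ.measurableSet_process_eq n k c).inter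
      (hξ.measurable _ _ (Set.toFinite {ι}).measurableSet)
  have key : ∀ ω, F (process (fun x i => ξ x i ω) n (k + 1)) = ∑ c ∈ reachable n k,
      ∑ ι ∈ instructions, Set.indicator ({ω | process (fun x i => ξ x i ω) n k = c} ∩
        {ω | nextInstruction (fun x i => ξ x i ω) c = ι})
        (fun _ => F (if IsStableConfig c.1 then c else execute c ι)) ω := by
    intro ω
    rw [Finset.sum_eq_single_of_mem _ (process_mem_reachable (fun x i => ξ x i ω) n k),
      Finset.sum_eq_single_of_mem _ (mem_instructions (nextInstruction (fun x i => ξ x i ω)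
        (process (fun x i => ξ x i ω) n k)))]
    · rw [Set.indicator_of_mem (Set.mem_inter (by rfl) (by rfl)), process_succ]
      split_ifs with h
      · rw [step_of_stable _ h]
      · rw [step_of_not_stable _ h]
    · intro ι _ hι
      exact Set.indicator_of_notMem (fun h => hι h.2.symm) _
    · intro c _ hc
      exact Finset.sum_eq_zero fun ι _ => Set.indicator_of_notMem (fun h => hc h.1.symm) _
  simp only [key]
  rw [hξ.integral_process, integral_finsetSum _ fun c _ => integrable_finsetSum _ fun ι _ =>
    (integrable_const _).indicator (hmeas c ι)]
  refine Finset.sum_congr rfl fun c _ => ?_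
  rw [integral_finsetSum _ fun ι _ => (integrable_const _).indicator (hmeas c ι)]
  simp only [integral_indicator_const _ (hmeas c _), hξ.measureReal_inter, mul_smul,
    ← Finset.smul_sum]
  congr 1
  by_cases h : IsStableConfig c.1
  · simp only [h, if_true, transition, sum_instructions, instructionProb, ← add_smul]
    convert! one_smul ℝ (F c) using 2
    ring
  · simp only [h, if_false, transition]

end

/-! ### Martingales and moment bounds -/

section
variable {Ω : Type*} [MeasurableSpace Ω] {P : Measure Ω} {p : ℝ}
  {ξ : ℤ → ℕ → Ω → Instruction} [IsProbabilityMeasure P]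

theorem IsInstructionStack.integral_process_eq {E : Type*} [NormedAddCommGroup E]
    [NormedSpace ℝ E] [CompleteSpace E] (hξ : IsInstructionStack P p ξ) (n : ℕ)
    {F : Config × (ℤ →₀ ℕ) → E} (hF : ∀ c, ¬ IsStableConfig c.1 → transition p F c = F c) (k : ℕ) :
    ∫ ω, F (process (fun x i => ξ x i ω) n k) ∂P = F (Finsupp.single 0 n, 0) := by
  induction k with
  | zero => simp [process_zero]
  | succ k ih =>
    rw [hξ.integral_process_succ, ← ih]
    congr 1 with ω
    by_cases h : IsStableConfig (process (fun x i => ξ x i ω) n k).1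
    · exact transition_of_stable p F h
    · exact hF _ h

/-- The inequality is required only at visited states, because bounds on the toppled vertex come
from the hull. -/
theorem IsInstructionStack.integral_process_le (hξ : IsInstructionStack P p ξ) (n : ℕ)
    {F : Config × (ℤ →₀ ℕ) → ℝ} (hF : ∀ s k, ¬ IsStableConfig (process s n k).1 →
      transition p F (process s n k) ≤ F (process s n k)) (k : ℕ) :
    ∫ ω, F (process (fun x i => ξ x i ω) n k) ∂P ≤ F (Finsupp.single 0 n, 0) := by
  induction k with
  | zero => simp [process_zero]
  | succ k ih =>
    rw [hξ.integral_process_succ]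
    refine (integral_mono (hξ.integrable_process n k _) (hξ.integrable_process n k _)
      fun ω => ?_).trans ih
    by_cases h : IsStableConfig (process (fun x i => ξ x i ω) n k).1
    · exact (transition_of_stable p F h).le
    · exact hF _ _ h

/-- The compensated second moment. -/
noncomputable def compensatedMoment (p : ℝ) (c : Config × (ℤ →₀ ℕ)) : ℝ :=
  secondMoment c.1 - 2 * p * topplings c

/-- Toppling at `x` sends `p` particles each way in mean; the terms `±2x` cancel and `2p` remains.
-/
theorem IsInstructionStack.integral_compensatedMoment (hξ : IsInstructionStack P p ξ) (n k : ℕ) :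
    ∫ ω, compensatedMoment p (process (fun x i => ξ x i ω) n k) ∂P = 0 := by
  rw [hξ.integral_process_eq n _ k]
  · simp [compensatedMoment, secondMoment, particleSum_single, topplings, particleSum_zero]
  · intro c hc
    rw [transition_of_not_stable p _ hc, sum_instructions]
    simp only [compensatedMoment, secondMoment_execute hc, topplings_execute, instructionProb,
      Instruction.toLeft, Instruction.toRight, smul_eq_mul]
    push_cast
    ring

theorem IsInstructionStack.integral_centerOfMass_sq (hξ : IsInstructionStack P p ξ) (n k : ℕ) :
    ∫ ω, ((centerOfMass (process (fun x i => ξ x i ω) n k).1 : ℝ) ^ 2 -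
      2 * p * (1 - p) * topplings (process (fun x i => ξ x i ω) n k)) ∂P = 0 := by
  rw [hξ.integral_process_eq n (F := fun c => (centerOfMass c.1 : ℝ) ^ 2 -
      2 * p * (1 - p) * topplings c) _ k]
  · simp [centerOfMass_eq_particleSum, particleSum_single, topplings, particleSum_zero]
  · intro c hc
    rw [transition_of_not_stable p _ hc, sum_instructions]
    simp only [centerOfMass_execute hc, topplings_execute, instructionProb,
      Instruction.toLeft, Instruction.toRight, smul_eq_mul]
    push_cast
    ring

theorem IsInstructionStack.integral_compensatedMoment_sq_le (hξ : IsInstructionStack P p ξ)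
    (hp0 : 0 ≤ p) (hp1 : p ≤ 1) {n : ℕ} (hn : 0 < n) (k : ℕ) :
    ∫ ω, (compensatedMoment p (process (fun x i => ξ x i ω) n k) ^ 2 -
      25 * n ^ 2 * topplings (process (fun x i => ξ x i ω) n k)) ∂P ≤ 0 := by
  refine (hξ.integral_process_le n (F := fun c => compensatedMoment p c ^ 2 -
      25 * n ^ 2 * topplings c) (fun s k h => ?_) k).trans_eq ?_
  · have hx := abs_leftmostUnstable_process_le hn h
    generalize process s n k = c at *
    rw [transition_of_not_stable p _ h, sum_instructions]
    simp only [compensatedMoment, secondMoment_execute h, topplings_execute, instructionProb,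
      Instruction.toLeft, Instruction.toRight, smul_eq_mul]
    push_cast
    have hx' : |(leftmostUnstable c.1 : ℝ)| ≤ n := by exact_mod_cast hx
    rw [abs_le] at hx'
    generalize (leftmostUnstable c.1 : ℝ) = x at *
    have hn1 : (1 : ℝ) ≤ n := by exact_mod_cast hn
    have hq : 0 ≤ p * (1 - p) := mul_nonneg hp0 (by linarith)
    -- As `|x| ≤ n` and `n ≥ 1`, each of the four possible increments of the compensated moment is
    -- at most `5n` in absolute value.
    have hb : ∀ d : ℝ, |d| ≤ 5 * n → d ^ 2 ≤ 25 * (n : ℝ) ^ 2 := fun d hd => by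
      have := sq_le_sq' (by linarith [abs_le.mp hd]) (abs_le.mp hd).2
      linarith
    have e1 := mul_le_mul_of_nonneg_left (hb (-2 * x + 1 - 2 * p)
      (abs_le.mpr ⟨by linarith, by linarith⟩)) hq
    have e2 := mul_le_mul_of_nonneg_left (hb (2 * x + 1 - 2 * p)
      (abs_le.mpr ⟨by linarith, by linarith⟩)) hq
    have e3 := mul_le_mul_of_nonneg_left (hb (2 - 2 * p)
      (abs_le.mpr ⟨by linarith, by linarith⟩)) (sq_nonneg p)
    have e4 := mul_le_mul_of_nonneg_left (hb (-2 * p)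
      (abs_le.mpr ⟨by linarith, by linarith⟩)) (sq_nonneg (1 - p))
    linarith
  · simp [compensatedMoment, secondMoment, particleSum_single, topplings, particleSum_zero]

/-- The characteristic function of the displacement of the center of mass in one toppling. -/
noncomputable def stepCharFun (p s : ℝ) : ℝ := 1 - 2 * (p * (1 - p)) * (1 - Real.cos s)

/-- The law of the displacement does not depend on the state, so each toppling multiplies the
conditional mean of the exponential by `stepCharFun p s`, which the power compensates. -/
theorem IsInstructionStack.integral_exp_mul_zpow (hξ : IsInstructionStack P p ξ) {s : ℝ}
    (hs : stepCharFun p s ≠ 0) (n k : ℕ) :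
    ∫ ω, Complex.exp (s * centerOfMass (process (fun x i => ξ x i ω) n k).1 * Complex.I) *
      ((stepCharFun p s ^ (-topplings (process (fun x i => ξ x i ω) n k)) : ℝ) : ℂ) ∂P = 1 := by
  rw [hξ.integral_process_eq n (F := fun c => Complex.exp (s * centerOfMass c.1 * Complex.I) *
      ((stepCharFun p s ^ (-topplings c) : ℝ) : ℂ)) _ k]
  · simp [centerOfMass_eq_particleSum, particleSum_single, topplings, particleSum_zero]
  · intro c hc
    rw [transition_of_not_stable p _ hc, sum_instructions]
    simp only [centerOfMass_execute hc, topplings_execute, instructionProb,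
      Instruction.toLeft, Instruction.toRight, Complex.real_smul]
    have hz : stepCharFun p s ^ (-topplings c) =
        stepCharFun p s * stepCharFun p s ^ (-(topplings c + 1)) := by
      rw [← zpow_one_add₀ hs]; congr 1; ring
    rw [hz]
    generalize stepCharFun p s ^ (-(topplings c + 1)) = z
    have h1 : Complex.exp (s * ((centerOfMass c.1 - (1 : ℕ) + (0 : ℕ) : ℤ) : ℂ) * Complex.I) =
        Complex.exp (s * centerOfMass c.1 * Complex.I) * Complex.exp (-s * Complex.I) := by
      rw [← Complex.exp_add]; push_cast; ring_nf
    have h2 : Complex.exp (s * ((centerOfMass c.1 - (0 : ℕ) + (1 : ℕ) : ℤ) : ℂ) * Complex.I) =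
        Complex.exp (s * centerOfMass c.1 * Complex.I) * Complex.exp (s * Complex.I) := by
      rw [← Complex.exp_add]; push_cast; ring_nf
    have h3 : ((centerOfMass c.1 - (1 : ℕ) + (1 : ℕ) : ℤ) : ℂ) = centerOfMass c.1 := by simp
    have h4 : ((centerOfMass c.1 - (0 : ℕ) + (0 : ℕ) : ℤ) : ℂ) = centerOfMass c.1 := by simp
    rw [h1, h2, h3, h4]
    have hcos : Complex.cos s = (Complex.exp (s * Complex.I) + Complex.exp (-s * Complex.I)) / 2 :=
      rfl
    simp only [stepCharFun]
    push_cast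
    rw [hcos]
    ring

theorem IsInstructionStack.integral_topplings_le (hξ : IsInstructionStack P p ξ)
    (hp0 : 0 < p) {n : ℕ} (hn : 0 < n) (k : ℕ) :
    ∫ ω, (topplings (process (fun x i => ξ x i ω) n k) : ℝ) ∂P ≤ n ^ 3 / (2 * p) := by
  have h := hξ.integral_compensatedMoment n k
  simp only [compensatedMoment] at h
  rw [integral_sub (hξ.integrable_process n k fun c => (secondMoment c.1 : ℝ))
    (hξ.integrable_process n k fun c => 2 * p * (topplings c : ℝ)), integral_const_mul] at h
  have hS : ∫ ω, (secondMoment (process (fun x i => ξ x i ω) n k).1 : ℝ) ∂P ≤ n ^ 3 := by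
    refine (integral_mono (hξ.integrable_process n k fun c => (secondMoment c.1 : ℝ))
      (integrable_const ((n : ℝ) ^ 3)) fun ω => ?_).trans_eq (by simp)
    have := secondMoment_process_le (fun x i => ξ x i ω) hn k
    change (secondMoment (process (fun x i => ξ x i ω) n k).1 : ℝ) ≤ (n : ℝ) ^ 3
    exact_mod_cast this
  rw [le_div_iff₀ (by linarith)]
  linarith

theorem IsInstructionStack.integral_centerOfMass_sq_le (hξ : IsInstructionStack P p ξ)
    (hp0 : 0 < p) (hp1 : p < 1) {n : ℕ} (hn : 0 < n) (k : ℕ) :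
    ∫ ω, (centerOfMass (process (fun x i => ξ x i ω) n k).1 : ℝ) ^ 2 ∂P ≤ n ^ 3 := by
  have h := hξ.integral_centerOfMass_sq n k
  rw [integral_sub (hξ.integrable_process n k fun c => (centerOfMass c.1 : ℝ) ^ 2)
    (hξ.integrable_process n k fun c => 2 * p * (1 - p) * (topplings c : ℝ)),
    integral_const_mul] at h
  have hT := hξ.integral_topplings_le hp0 hn k
  rw [le_div_iff₀ (by linarith)] at hT
  have : (0 : ℝ) < n ^ 3 := by positivity
  nlinarith

theorem IsInstructionStack.integral_compensatedMoment_sq_le' (hξ : IsInstructionStack P p ξ)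
    (hp0 : 0 < p) (hp1 : p < 1) {n : ℕ} (hn : 0 < n) (k : ℕ) :
    ∫ ω, compensatedMoment p (process (fun x i => ξ x i ω) n k) ^ 2 ∂P ≤
      25 * n ^ 5 / (2 * p) := by
  have h := hξ.integral_compensatedMoment_sq_le hp0.le hp1.le hn k
  rw [integral_sub (hξ.integrable_process n k fun c => compensatedMoment p c ^ 2)
    (hξ.integrable_process n k fun c => 25 * (n : ℝ) ^ 2 * (topplings c : ℝ)),
    integral_const_mul] at h
  have hT := mul_le_mul_of_nonneg_left (hξ.integral_topplings_le hp0 hn k)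
    (by positivity : (0 : ℝ) ≤ 25 * n ^ 2)
  calc _ ≤ _ := sub_nonpos.mp h
    _ ≤ _ := hT
    _ = _ := by ring

end

/-! ### Asymptotics of the one-step characteristic function -/

open Topology in
theorem tendsto_neg_log_stepCharFun (p t : ℝ) :
    Tendsto (fun n : ℕ => -((n : ℝ) ^ 3 * Real.log (stepCharFun p (t / (n : ℝ) ^ (3 / 2 : ℝ)))))
      atTop (𝓝 (p * (1 - p) * t ^ 2)) := by
  have hs : Tendsto (fun n : ℕ => t / (n : ℝ) ^ (3 / 2 : ℝ)) atTop (𝓝 0) :=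
    tendsto_const_nhds.div_atTop
      ((tendsto_rpow_atTop (by norm_num)).comp tendsto_natCast_atTop_atTop)
  have hφ0 : Tendsto (fun n : ℕ => stepCharFun p (t / (n : ℝ) ^ (3 / 2 : ℝ))) atTop (𝓝 1) := by
    have hc : Continuous (stepCharFun p) := by unfold stepCharFun; fun_prop
    have := (hc.tendsto 0).comp hs
    simpa only [Function.comp_def, stepCharFun, Real.cos_zero, sub_self, mul_zero, sub_zero]
      using this
  have hr : Tendsto (fun n : ℕ => (n : ℝ) ^ 3 * (1 - stepCharFun p (t / (n : ℝ) ^ (3 / 2 : ℝ))))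
      atTop (𝓝 (p * (1 - p) * t ^ 2)) := by
    -- Since `1 - cos s = 2 sin²(s/2)`, this is `n³(1 - φ)` written without a singularity at `s =
    -- 0`.
    have h1 : Tendsto (fun n : ℕ => p * (1 - p) * t ^ 2 *
        Real.sinc (t / (n : ℝ) ^ (3 / 2 : ℝ) / 2) ^ 2) atTop (𝓝 (p * (1 - p) * t ^ 2)) := by
      have h2 : Continuous fun s : ℝ => p * (1 - p) * t ^ 2 * Real.sinc (s / 2) ^ 2 := by
        have := Real.continuous_sinc
        fun_prop
      simpa [Function.comp_def] using (h2.tendsto 0).comp hs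
    refine h1.congr' ?_
    filter_upwards [eventually_gt_atTop 0] with n hn
    have hn' : (0 : ℝ) < n := by exact_mod_cast hn
    have hpow : ((n : ℝ) ^ (3 / 2 : ℝ)) ^ 2 = n ^ 3 := by
      rw [← Real.rpow_natCast, ← Real.rpow_mul hn'.le, ← Real.rpow_natCast]; norm_num
    have hpos : (0 : ℝ) < (n : ℝ) ^ (3 / 2 : ℝ) := Real.rpow_pos_of_pos hn' _
    rw [← hpow]
    generalize (n : ℝ) ^ (3 / 2 : ℝ) = a at *
    have hcos : Real.cos (t / a) = 1 - 2 * Real.sin (t / a / 2) ^ 2 := by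
      rw [← Real.cos_sq_add_sin_sq (t / a / 2), ← mul_div_cancel₀ (t / a) (two_ne_zero),
        Real.cos_two_mul']
      ring_nf
    have hsin : t / a / 2 * Real.sinc (t / a / 2) = Real.sin (t / a / 2) := by
      by_cases h0 : t / a / 2 = 0
      · simp [h0]
      · rw [Real.sinc_of_ne_zero h0, mul_div_cancel₀ _ h0]
    rw [stepCharFun, hcos, ← hsin]
    field_simp
    ring
  have hr' : Tendsto (fun n : ℕ => (n : ℝ) ^ 3 *
      (1 - stepCharFun p (t / (n : ℝ) ^ (3 / 2 : ℝ))) *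
        (stepCharFun p (t / (n : ℝ) ^ (3 / 2 : ℝ)))⁻¹) atTop (𝓝 (p * (1 - p) * t ^ 2)) := by
    simpa using hr.mul (hφ0.inv₀ one_ne_zero)
  -- Squeeze by `1 - φ ≤ -log φ ≤ (1 - φ)/φ`.
  refine tendsto_of_tendsto_of_tendsto_of_le_of_le' hr hr' ?_ ?_
  · filter_upwards [hφ0.eventually (lt_mem_nhds zero_lt_one)] with n hn
    have := Real.log_le_sub_one_of_pos hn
    have h3 : (0 : ℝ) ≤ (n : ℝ) ^ 3 := by positivity
    nlinarith
  · filter_upwards [hφ0.eventually (lt_mem_nhds zero_lt_one)] with n hn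
    have := Real.one_sub_inv_le_log_of_pos hn
    have h3 : (0 : ℝ) ≤ (n : ℝ) ^ 3 := by positivity
    rw [mul_assoc, sub_mul, mul_inv_cancel₀ hn.ne', one_mul, ← mul_neg]
    exact mul_le_mul_of_nonneg_left (by linarith) h3

/-! ### The horizon and the law of large numbers for topplings -/

/-- A time by which the stabilization of `n` particles has terminated with high probability. -/
noncomputable def horizon (p : ℝ) (n : ℕ) : ℕ := ⌈((n : ℝ) + 1) ^ 3 / p⌉₊

theorem horizon_le {p : ℝ} (hp0 : 0 < p) {n : ℕ} (hn : 0 < n) :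
    (horizon p n : ℝ) ≤ (8 / p + 1) * n ^ 3 := by
  have h := (Nat.ceil_lt_add_one (by positivity : 0 ≤ ((n : ℝ) + 1) ^ 3 / p)).le
  have hn1 : (1 : ℝ) ≤ n := by exact_mod_cast hn
  refine h.trans ?_
  have h1 : ((n : ℝ) + 1) ^ 3 ≤ (2 * n) ^ 3 := pow_le_pow_left₀ (by positivity) (by linarith) 3
  have h2 : ((n : ℝ) + 1) ^ 3 / p ≤ (2 * n) ^ 3 / p := by gcongr
  have h3 : (1 : ℝ) ≤ n ^ 3 := one_le_pow₀ hn1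
  calc _ ≤ (2 * (n : ℝ)) ^ 3 / p + n ^ 3 := by linarith
    _ = _ := by ring

/-- While unstable, every step is a toppling, so `2pT ≥ 2n³` at the horizon, whereas `S ≤ n³`.
Instability therefore forces a large deviation of the compensated moment. -/
theorem le_compensatedMoment_sq {p : ℝ} (hp0 : 0 < p) {n : ℕ} (hn : 0 < n)
    {s : ℤ → ℕ → Instruction} (h : ¬ IsStableConfig (process s n (horizon p n)).1) :
    (n : ℝ) ^ 6 ≤ compensatedMoment p (process s n (horizon p n)) ^ 2 := by
  have hS : (secondMoment (process s n (horizon p n)).1 : ℝ) ≤ n ^ 3 := by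
    exact_mod_cast secondMoment_process_le s hn (horizon p n)
  have hk : ((n : ℝ) + 1) ^ 3 / p ≤ horizon p n := Nat.le_ceil _
  rw [div_le_iff₀ hp0] at hk
  have h1 : (n : ℝ) ^ 3 ≤ ((n : ℝ) + 1) ^ 3 := pow_le_pow_left₀ (by positivity) (by linarith) 3
  have h2 : (n : ℝ) ^ 3 ≤ -compensatedMoment p (process s n (horizon p n)) := by
    rw [compensatedMoment, topplings_process_of_not_stable h]
    push_cast
    linarith
  calc (n : ℝ) ^ 6 = ((n : ℝ) ^ 3) ^ 2 := by ring
    _ ≤ _ := pow_le_pow_left₀ (by positivity) h2 2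
    _ = _ := by ring

/-- A pointwise bound for the deviation of the rescaled number of topplings. -/
theorem abs_topplings_sub_le {p : ℝ} (hp0 : 0 < p) {n : ℕ} (hn : 0 < n)
    (s : ℤ → ℕ → Instruction) :
    |topplings (process s n (horizon p n)) / (n : ℝ) ^ 3 - 1 / (24 * p)| ≤
      (12 * (centerOfMass (process s n (horizon p n)).1 : ℝ) ^ 2 + 13 * n ^ 3 +
        12 * n * (n ^ 2 * √n +
          compensatedMoment p (process s n (horizon p n)) ^ 2 / (n ^ 2 * √n))) /
            (24 * p * n ^ 4) +
      (8 / p + 1 + 1 / (24 * p)) *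
        (compensatedMoment p (process s n (horizon p n)) ^ 2 / n ^ 6) := by
  have hn' : (0 : ℝ) < n := by exact_mod_cast hn
  by_cases h : IsStableConfig (process s n (horizon p n)).1
  · refine le_add_of_le_of_nonneg ?_ (by positivity)
    obtain ⟨a, b, hull⟩ := exists_hasHull_process s hn (horizon p n)
    have hv := hull.abs_variance_sub_le h hn (particleSum_one_process s n _)
    have hv' : |12 * ((n : ℝ) * secondMoment (process s n (horizon p n)).1 -
        (centerOfMass (process s n (horizon p n)).1 : ℝ) ^ 2) - (n : ℝ) ^ 4| ≤ 13 * (n : ℝ) ^ 3 := by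
      exact_mod_cast hv
    have hN : compensatedMoment p (process s n (horizon p n)) =
      secondMoment (process s n (horizon p n)).1 - 2 * p * topplings (process s n (horizon p n)) :=
      rfl
    generalize compensatedMoment p (process s n (horizon p n)) = N at *
    generalize (secondMoment (process s n (horizon p n)).1 : ℝ) = S at *
    generalize (centerOfMass (process s n (horizon p n)).1 : ℝ) = M at *
    generalize (topplings (process s n (horizon p n)) : ℝ) = T at *
    have ha : 0 < (n : ℝ) ^ 2 * √n := by positivity
    -- Only the second moment of `N` is controlled, by order `n⁵`; splitting at the scale `n^(5/2)`
    -- makes both terms of that order in mean.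
    have hNa : |N| ≤ (n : ℝ) ^ 2 * √n + N ^ 2 / (n ^ 2 * √n) := by
      generalize (n : ℝ) ^ 2 * √n = a at *
      rw [← sq_abs, ← sub_le_iff_le_add', le_div_iff₀ ha]
      nlinarith [sq_nonneg (|N| - a), abs_nonneg N]
    have heq : T / (n : ℝ) ^ 3 - 1 / (24 * p) = (12 * M ^ 2 +
        (12 * (n * S - M ^ 2) - n ^ 4) - 12 * n * N) / (24 * p * n ^ 4) := by
      rw [hN]; field_simp; ring
    rw [heq, abs_div, abs_of_pos (by positivity : 0 < 24 * p * (n : ℝ) ^ 4)]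
    gcongr
    have h12 : (0 : ℝ) ≤ 12 * n := by positivity
    have hm := mul_le_mul_of_nonneg_left hNa h12
    have hM := sq_nonneg M
    have hnN : |12 * n * N| = 12 * n * |N| := by rw [abs_mul, abs_of_nonneg h12]
    have h1 := abs_sub (12 * M ^ 2 + (12 * (n * S - M ^ 2) - (n : ℝ) ^ 4)) (12 * n * N)
    have h2 := abs_add_le (12 * M ^ 2) (12 * (n * S - M ^ 2) - (n : ℝ) ^ 4)
    rw [abs_of_nonneg (by positivity : 0 ≤ 12 * M ^ 2)] at h2
    linarith
  -- If still unstable, `N²/n⁶ ≥ 1`, so the crude bound on `T/n³` from the horizon suffices.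
  · refine le_add_of_nonneg_of_le (by positivity) ?_
    have hT := topplings_process_le s n (horizon p n)
    have hT' : (topplings (process s n (horizon p n)) : ℝ) ≤ horizon p n := by exact_mod_cast hT
    have hT0 : (0 : ℝ) ≤ topplings (process s n (horizon p n)) := by
      exact_mod_cast topplings_nonneg _
    have hk := hT'.trans (horizon_le hp0 hn)
    rw [← div_le_iff₀ (by positivity)] at hk
    have h6 := le_compensatedMoment_sq hp0 hn h
    have h7 : 1 ≤ compensatedMoment p (process s n (horizon p n)) ^ 2 / (n : ℝ) ^ 6 := by
      rwa [le_div_iff₀ (by positivity), one_mul]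
    calc _ ≤ 8 / p + 1 + 1 / (24 * p) := by
          have h0 : 0 ≤ 1 / (24 * p) := by positivity
          have h1 : 0 ≤ 8 / p + 1 := by positivity
          have h2 : 0 ≤ (topplings (process s n (horizon p n)) : ℝ) / (n : ℝ) ^ 3 := by positivity
          rw [abs_le]
          constructor <;> linarith
      _ ≤ _ := le_mul_of_one_le_right (by positivity) h7

section
variable {Ω : Type*} [MeasurableSpace Ω] {P : Measure Ω} {p : ℝ}
  {ξ : ℤ → ℕ → Ω → Instruction} [IsProbabilityMeasure P]

theorem integral_linear_combination {f g : Ω → ℝ} (hf : Integrable f P) (hg : Integrable g P)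
    (a b c : ℝ) : ∫ ω, (a * f ω + (b * g ω + c)) ∂P = a * ∫ ω, f ω ∂P + (b * ∫ ω, g ω ∂P + c) := by
  rw [integral_add (g := fun ω => b * g ω + c) (hf.const_mul a)
    ((hg.const_mul b).add (integrable_const c)),
    integral_const_mul]
  congr 1
  exact (integral_add (hg.const_mul b) (integrable_const c)).trans
    (by rw [integral_const_mul, integral_const]; simp)

open Topology in
/-- The number of topplings is asymptotic to `n ^ 3 / (24 * p)` in mean. -/
theorem IsInstructionStack.tendsto_integral_abs_topplings_sub (hξ : IsInstructionStack P p ξ)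
    (hp0 : 0 < p) (hp1 : p < 1) :
    Tendsto (fun n : ℕ => ∫ ω, |topplings (process (fun x i => ξ x i ω) n (horizon p n)) /
      (n : ℝ) ^ 3 - 1 / (24 * p)| ∂P) atTop (𝓝 0) := by
  have hlim : Tendsto (fun n : ℕ => (25 / √n ^ 2 + 12 / √n + 12 * 25 / (2 * p) / √n) / (24 * p) +
      (8 / p + 1 + 1 / (24 * p)) * (25 / (2 * p) / √n ^ 2)) atTop (𝓝 0) := by
    have hsq : Tendsto (fun n : ℕ => (√n)⁻¹) atTop (𝓝 0) :=
      tendsto_inv_atTop_zero.comp (Real.tendsto_sqrt_atTop.comp tendsto_natCast_atTop_atTop)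
    have hc : Continuous fun x : ℝ => (25 * x ^ 2 + 12 * x + 12 * 25 / (2 * p) * x) / (24 * p) +
      (8 / p + 1 + 1 / (24 * p)) * (25 / (2 * p) * x ^ 2) := by fun_prop
    have := (hc.tendsto 0).comp hsq
    simpa [Function.comp_def, div_eq_mul_inv, inv_pow] using this
  refine squeeze_zero' (Eventually.of_forall fun n => integral_nonneg fun ω => abs_nonneg _) ?_ hlim
  filter_upwards [eventually_gt_atTop 0] with n hn
  have hn' : (0 : ℝ) < n := by exact_mod_cast hn
  have iM := hξ.integrable_process n (horizon p n) fun c => (centerOfMass c.1 : ℝ) ^ 2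
  have iN := hξ.integrable_process n (horizon p n) fun c => compensatedMoment p c ^ 2
  refine (integral_mono (hξ.integrable_process n (horizon p n) fun c =>
    |topplings c / (n : ℝ) ^ 3 - 1 / (24 * p)|) (hξ.integrable_process n (horizon p n) fun c =>
      (12 * (centerOfMass c.1 : ℝ) ^ 2 + 13 * n ^ 3 + 12 * n * (n ^ 2 * √n +
        compensatedMoment p c ^ 2 / (n ^ 2 * √n))) / (24 * p * n ^ 4) +
          (8 / p + 1 + 1 / (24 * p)) * (compensatedMoment p c ^ 2 / n ^ 6))
      fun ω => abs_topplings_sub_le hp0 hn fun x i => ξ x i ω).trans ?_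
  have hM := hξ.integral_centerOfMass_sq_le hp0 hp1 hn (horizon p n)
  have hN := hξ.integral_compensatedMoment_sq_le' hp0 hp1 hn (horizon p n)
  have hlin := integral_linear_combination iM iN (12 / (24 * p * n ^ 4))
    (12 * n / (n ^ 2 * √n) / (24 * p * n ^ 4) + (8 / p + 1 + 1 / (24 * p)) / n ^ 6)
    ((13 * n ^ 3 + 12 * n * (n ^ 2 * √n)) / (24 * p * n ^ 4))
  refine (integral_congr_ae (Eventually.of_forall fun ω => ?_)).trans hlin |>.trans_le ?_
  · ring
  generalize ∫ ω, (centerOfMass (process (fun x i => ξ x i ω) n (horizon p n)).1 : ℝ) ^ 2 ∂P = A at *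
  generalize ∫ ω, compensatedMoment p (process (fun x i => ξ x i ω) n (horizon p n)) ^ 2 ∂P = B at *
  calc _ = (12 * A + 13 * n ^ 3 + 12 * n * (n ^ 2 * √n + B / (n ^ 2 * √n))) / (24 * p * n ^ 4) +
        (8 / p + 1 + 1 / (24 * p)) * (B / n ^ 6) := by ring
    _ ≤ (12 * (n : ℝ) ^ 3 + 13 * n ^ 3 + 12 * n * (n ^ 2 * √n +
        25 * n ^ 5 / (2 * p) / (n ^ 2 * √n))) / (24 * p * n ^ 4) +
        (8 / p + 1 + 1 / (24 * p)) * (25 * n ^ 5 / (2 * p) / n ^ 6) := by gcongr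
    _ = _ := by
      have hsq : √(n : ℝ) ^ 2 = n := Real.sq_sqrt hn'.le
      have hs : 0 < √(n : ℝ) := Real.sqrt_pos.mpr hn'
      generalize √(n : ℝ) = r at *
      rw [← hsq]
      field_simp
      ring

/-- The stabilization has terminated at the horizon with high probability. -/
theorem IsInstructionStack.measureReal_not_stable_le (hξ : IsInstructionStack P p ξ)
    (hp0 : 0 < p) (hp1 : p < 1) {n : ℕ} (hn : 0 < n) :
    P.real {ω | ¬ IsStableConfig (process (fun x i => ξ x i ω) n (horizon p n)).1} ≤
      25 / (2 * p) / n := by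
  have hn' : (0 : ℝ) < n := by exact_mod_cast hn
  have iN := hξ.integrable_process n (horizon p n) fun c => compensatedMoment p c ^ 2
  have h1 := mul_meas_ge_le_integral_of_nonneg (Eventually.of_forall fun ω => sq_nonneg
    (compensatedMoment p (process (fun x i => ξ x i ω) n (horizon p n)))) iN ((n : ℝ) ^ 6)
  have h2 := h1.trans (hξ.integral_compensatedMoment_sq_le' hp0 hp1 hn (horizon p n))
  have h3 : P.real {ω | ¬ IsStableConfig (process (fun x i => ξ x i ω) n (horizon p n)).1} ≤
      P.real {ω | (n : ℝ) ^ 6 ≤ compensatedMoment p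
        (process (fun x i => ξ x i ω) n (horizon p n)) ^ 2} :=
    measureReal_mono fun ω hω => le_compensatedMoment_sq hp0 hn hω
  refine h3.trans ?_
  rw [mul_comm, ← le_div_iff₀ (by positivity)] at h2
  refine h2.trans_eq ?_
  field_simp

/-- The stabilization terminates almost surely. -/
theorem IsInstructionStack.ae_exists_stable (hξ : IsInstructionStack P p ξ) (hp0 : 0 < p) (n : ℕ) :
    ∀ᵐ ω ∂P, ∃ k, IsStableConfig (process (fun x i => ξ x i ω) n k).1 := by
  rcases Nat.eq_zero_or_pos n with rfl | hn
  · exact Eventually.of_forall fun ω => ⟨0, by simp [process_zero, IsStableConfig]⟩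
  rw [ae_iff]
  set A := {ω | ¬ ∃ k, IsStableConfig (process (fun x i => ξ x i ω) n k).1} with hA
  -- On `A` there have been exactly `k` topplings after `k` steps, while the mean number is bounded
  -- uniformly in `k`.
  have hbound : ∀ k : ℕ, k * P.real A ≤ (n : ℝ) ^ 3 / (2 * p) := fun k => by
    refine le_trans ?_ (hξ.integral_topplings_le hp0 hn k)
    refine le_trans ?_ (mul_meas_ge_le_integral_of_nonneg (Eventually.of_forall fun ω => ?_)
      (hξ.integrable_process n k fun c => (topplings c : ℝ)) k)
    · refine mul_le_mul_of_nonneg_left (measureReal_mono fun ω hω => ?_) k.cast_nonneg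
      rw [hA] at hω
      have := topplings_process_of_not_stable (not_exists.mp hω k)
      change (k : ℝ) ≤ topplings (process (fun x i => ξ x i ω) n k)
      rw [this]
      simp
    · change (0 : ℝ) ≤ topplings (process (fun x i => ξ x i ω) n k)
      exact_mod_cast topplings_nonneg _
  have h0 : P.real A = 0 := by
    by_contra hne
    have hpos : 0 < P.real A := lt_of_le_of_ne measureReal_nonneg (Ne.symm hne)
    obtain ⟨k, hk⟩ := exists_nat_gt ((n : ℝ) ^ 3 / (2 * p) / P.real A)
    rw [div_lt_iff₀ hpos] at hk
    exact absurd (hbound k) (not_le.mpr hk)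
  exact (measureReal_eq_zero_iff).mp h0

end

/-! ### Convergence of characteristic functions -/

theorem finalConfig_eq_of_stable {s : ℤ → ℕ → Instruction} {n k : ℕ}
    (h : IsStableConfig (process s n k).1) :
    stabTime s n ≠ ⊤ ∧ finalConfig s n = (process s n k).1 := by
  classical
  have hex : ∃ k, IsStableConfig (config s n k) := ⟨k, h⟩
  have hst : stabTime s n = Nat.find hex :=
    le_antisymm (iInf₂_le (Nat.find hex) (Nat.find_spec hex))
      (le_iInf₂ fun j hj => by exact_mod_cast Nat.find_min' hex hj)
  refine ⟨by simp [hst], ?_⟩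
  rw [finalConfig, hst, ENat.toNat_natCast, config,
    process_of_stable (k := Nat.find hex) (Nat.find_spec hex) (Nat.find_min' hex h)]

theorem abs_exp_sub_exp_le {x y C : ℝ} (hx : x ≤ C) (hy : y ≤ C) :
    |Real.exp x - Real.exp y| ≤ Real.exp C * |x - y| := by
  have key : ∀ u v : ℝ, u ≤ C → Real.exp u - Real.exp v ≤ Real.exp C * |u - v| := fun u v hu => by
    have h1 := Real.add_one_le_exp (v - u)
    have h2 : Real.exp v = Real.exp u * Real.exp (v - u) := by rw [← Real.exp_add]; ring_nf
    have h3 : Real.exp u - Real.exp v ≤ Real.exp u * (u - v) := by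
      rw [h2]; nlinarith [Real.exp_pos u]
    exact h3.trans ((mul_le_mul_of_nonneg_left (le_abs_self _) (Real.exp_pos u).le).trans
      (mul_le_mul_of_nonneg_right (Real.exp_le_exp.mpr hu) (abs_nonneg _)))
  rw [abs_le]
  refine ⟨?_, key x y hx⟩
  have := key y x hy
  rw [abs_sub_comm] at this
  linarith

theorem stepCharFun_le_one {p : ℝ} (hp0 : 0 ≤ p) (hp1 : p ≤ 1) (s : ℝ) : stepCharFun p s ≤ 1 := by
  have h1 := Real.cos_le_one s
  have h2 : 0 ≤ p * (1 - p) := mul_nonneg hp0 (by linarith)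
  rw [stepCharFun]
  nlinarith [mul_nonneg h2 (sub_nonneg.mpr h1)]

theorem stepCharFun_zpow_eq {p s : ℝ} (hs : 0 < stepCharFun p s) {n : ℕ} (hn : 0 < n) (T : ℤ) :
    stepCharFun p s ^ (-T) =
      Real.exp (-((n : ℝ) ^ 3 * Real.log (stepCharFun p s)) * (T / (n : ℝ) ^ 3)) := by
  have hn' : (0 : ℝ) < n := by exact_mod_cast hn
  have h : -((n : ℝ) ^ 3 * Real.log (stepCharFun p s)) * (T / (n : ℝ) ^ 3) =
      ((-T : ℤ) : ℝ) * Real.log (stepCharFun p s) := by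
    push_cast; field_simp
  rw [h, mul_comm, Real.exp_mul, Real.exp_log hs, Real.rpow_intCast]

theorem abs_exp_sub_exp_mul_le {x y θ τ C K : ℝ} (hx : x ≤ K) (hy0 : 0 ≤ y) (hy : y ≤ K)
    (hτ0 : 0 ≤ τ) (hτ : τ ≤ C) (hθ0 : 0 ≤ θ) (hθ : θ ≤ C) :
    |Real.exp (x * τ) - Real.exp (y * θ)| ≤ Real.exp (K * C) * (C * |y - x| + K * |θ - τ|) := by
  have hK : 0 ≤ K := hy0.trans hy
  refine (abs_exp_sub_exp_le (C := K * C)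
    ((mul_le_mul_of_nonneg_right hx hτ0).trans (mul_le_mul_of_nonneg_left hτ hK))
    (mul_le_mul hy hθ hθ0 hK)).trans ?_
  refine mul_le_mul_of_nonneg_left ?_ (Real.exp_pos _).le
  have : x * τ - y * θ = -(τ * (y - x) + y * (θ - τ)) := by ring
  rw [this, abs_neg]
  refine (abs_add_le _ _).trans ?_
  rw [abs_mul, abs_mul, abs_of_nonneg hτ0, abs_of_nonneg hy0]
  gcongr

section
variable {Ω : Type*} [MeasurableSpace Ω] {P : Measure Ω} {p : ℝ}
  {ξ : ℤ → ℕ → Ω → Instruction} [IsProbabilityMeasure P]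

/-- Writing `1` as the mean of the exponential martingale leaves a factor of modulus one times the
difference of two real exponentials, of `x/(24p)` and of `-n³ log φ · T/n³`. Both exponents are
bounded, since `T/n³ ≤ 8/p + 1` at the horizon. -/
theorem IsInstructionStack.norm_integral_exp_mul_sub_one_le (hξ : IsInstructionStack P p ξ)
    (hp0 : 0 < p) (hp1 : p < 1) {n : ℕ} (hn : 0 < n) {s x K : ℝ} (hs : 0 < stepCharFun p s)
    (hx : x ≤ K) (hK : -((n : ℝ) ^ 3 * Real.log (stepCharFun p s)) ≤ K) :
    ‖(∫ ω, Complex.exp (s * centerOfMass (process (fun x i => ξ x i ω) n (horizon p n)).1 *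
        Complex.I) ∂P) * (Real.exp (x * (1 / (24 * p))) : ℝ) - 1‖ ≤
      Real.exp (K * (8 / p + 1)) *
        ((8 / p + 1) * |-((n : ℝ) ^ 3 * Real.log (stepCharFun p s)) - x| +
          K * ∫ ω, |topplings (process (fun x i => ξ x i ω) n (horizon p n)) /
            (n : ℝ) ^ 3 - 1 / (24 * p)| ∂P) := by
  have hn' : (0 : ℝ) < n := by exact_mod_cast hn
  rw [← hξ.integral_exp_mul_zpow hs.ne' n (horizon p n), ← integral_mul_const,
    ← integral_sub
      (hξ.integrable_process n (horizon p n) fun c => Complex.exp (s * centerOfMass c.1 *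
        Complex.I) * ((Real.exp (x * (1 / (24 * p))) : ℝ) : ℂ))
      (hξ.integrable_process n (horizon p n) fun c => Complex.exp (s * centerOfMass c.1 *
        Complex.I) * ((stepCharFun p s ^ (-topplings c) : ℝ) : ℂ))]
  set y := -((n : ℝ) ^ 3 * Real.log (stepCharFun p s)) with hy
  have hy0 : 0 ≤ y := by
    have := Real.log_nonpos hs.le (stepCharFun_le_one hp0.le hp1.le s)
    have h3 : (0 : ℝ) ≤ (n : ℝ) ^ 3 := by positivity
    rw [hy]
    nlinarith
  refine (norm_integral_le_integral_norm _).trans ?_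
  have hD := hξ.integrable_process n (horizon p n) fun c =>
    |(topplings c : ℝ) / (n : ℝ) ^ 3 - 1 / (24 * p)|
  have hlin : Real.exp (K * (8 / p + 1)) * ((8 / p + 1) * |y - x| + K * ∫ ω,
      |topplings (process (fun x i => ξ x i ω) n (horizon p n)) /
        (n : ℝ) ^ 3 - 1 / (24 * p)| ∂P) = ∫ ω, Real.exp (K * (8 / p + 1)) * ((8 / p + 1) * |y - x| +
      K * |topplings (process (fun x i => ξ x i ω) n (horizon p n)) /
        (n : ℝ) ^ 3 - 1 / (24 * p)|) ∂P := by
    rw [integral_const_mul, integral_add (integrable_const _) (hD.const_mul K),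
      integral_const_mul K, integral_const]
    simp
  rw [hlin]
  refine integral_mono
    (hξ.integrable_process n (horizon p n) fun c => ‖Complex.exp (s * centerOfMass c.1 *
        Complex.I) * ((Real.exp (x * (1 / (24 * p))) : ℝ) : ℂ) - Complex.exp (s * centerOfMass c.1 *
        Complex.I) * ((stepCharFun p s ^ (-topplings c) : ℝ) : ℂ)‖)
    (((integrable_const _).add (hD.const_mul K)).const_mul _) fun ω => ?_
  generalize hc : process (fun x i => ξ x i ω) n (horizon p n) = c
  have hT : (topplings c : ℝ) ≤ horizon p n := by
    rw [← hc]; exact_mod_cast topplings_process_le _ n (horizon p n)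
  have hT0 : (0 : ℝ) ≤ topplings c := by exact_mod_cast topplings_nonneg c
  have hk := hT.trans (horizon_le hp0 hn)
  rw [← div_le_iff₀ (by positivity)] at hk
  have hexp := Complex.norm_exp_ofReal_mul_I (s * centerOfMass c.1)
  push_cast at hexp
  rw [← mul_sub, norm_mul, hexp, one_mul, ← Complex.ofReal_sub, Complex.norm_real,
    Real.norm_eq_abs, stepCharFun_zpow_eq hs hn]
  refine abs_exp_sub_exp_mul_le hx hy0 hK (by positivity) ?_ (by positivity) hk
  have h24 : 1 / (24 * p) ≤ 8 / p := by
    rw [div_le_div_iff₀ (by positivity) hp0]; linarith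
  linarith

open Topology in
/-- The characteristic function of the rescaled center of mass at the horizon converges. -/
theorem IsInstructionStack.tendsto_integral_exp (hξ : IsInstructionStack P p ξ)
    (hp0 : 0 < p) (hp1 : p < 1) (t : ℝ) :
    Tendsto (fun n : ℕ => ∫ ω, Complex.exp ((t / (n : ℝ) ^ (3 / 2 : ℝ) : ℝ) *
      centerOfMass (process (fun x i => ξ x i ω) n (horizon p n)).1 * Complex.I) ∂P) atTop
      (𝓝 (Real.exp (-(p * (1 - p) * t ^ 2 * (1 / (24 * p)))) : ℝ)) := by
  have hlog := tendsto_neg_log_stepCharFun p t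
  set x := p * (1 - p) * t ^ 2
  have hφ : ∀ᶠ n : ℕ in atTop, 0 < stepCharFun p (t / (n : ℝ) ^ (3 / 2 : ℝ)) := by
    have hs : Tendsto (fun n : ℕ => t / (n : ℝ) ^ (3 / 2 : ℝ)) atTop (𝓝 0) :=
      tendsto_const_nhds.div_atTop
        ((tendsto_rpow_atTop (by norm_num)).comp tendsto_natCast_atTop_atTop)
    have hc : Continuous (stepCharFun p) := by unfold stepCharFun; fun_prop
    have h0 : (0 : ℝ) < stepCharFun p 0 := by simp [stepCharFun]
    exact hs.eventually ((hc.tendsto 0).eventually (lt_mem_nhds h0))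
  have hbound : Tendsto (fun n : ℕ => Real.exp ((x + 1) * (8 / p + 1)) *
        ((8 / p + 1) * |-((n : ℝ) ^ 3 * Real.log (stepCharFun p (t / (n : ℝ) ^ (3 / 2 : ℝ)))) - x| +
          (x + 1) * ∫ ω, |topplings (process (fun x i => ξ x i ω) n (horizon p n)) /
            (n : ℝ) ^ 3 - 1 / (24 * p)| ∂P)) atTop (𝓝 0) := by
    have h1 := ((hlog.sub_const x).abs.const_mul (8 / p + 1)).add
      ((hξ.tendsto_integral_abs_topplings_sub hp0 hp1).const_mul (x + 1))
    simpa using h1.const_mul (Real.exp ((x + 1) * (8 / p + 1)))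
  have h1 : Tendsto (fun n : ℕ => (∫ ω, Complex.exp ((t / (n : ℝ) ^ (3 / 2 : ℝ) : ℝ) *
      centerOfMass (process (fun x i => ξ x i ω) n (horizon p n)).1 * Complex.I) ∂P) *
        (Real.exp (x * (1 / (24 * p))) : ℝ) - 1) atTop (𝓝 0) := by
    refine squeeze_zero_norm' ?_ hbound
    filter_upwards [hφ, eventually_gt_atTop 0,
      hlog.eventually (ge_mem_nhds (lt_add_one x))] with n h1 h2 h3
    exact hξ.norm_integral_exp_mul_sub_one_le hp0 hp1 h2 h1 (lt_add_one x).le h3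
  have h2 := (h1.add_const 1).mul_const ((Real.exp (-(x * (1 / (24 * p)))) : ℝ) : ℂ)
  have h3 : ((Real.exp (x * (1 / (24 * p))) : ℝ) : ℂ) *
      ((Real.exp (-(x * (1 / (24 * p)))) : ℝ) : ℂ) = 1 := by
    rw [← Complex.ofReal_mul, ← Real.exp_add]; simp
  simpa only [sub_add_cancel, zero_add, one_mul, mul_assoc, h3, mul_one] using h2

/-- Almost surely the process is eventually constant, so the final value is an almost sure limit of
measurable ones. -/
theorem IsInstructionStack.aemeasurable_centerOfMass_finalConfig (hξ : IsInstructionStack P p ξ)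
    (hp0 : 0 < p) (n : ℕ) : AEMeasurable
      (fun ω => (centerOfMass (finalConfig (fun x i => ξ x i ω) n) : ℝ)) P := by
  refine aemeasurable_of_tendsto_metrizable_ae atTop
    (fun k => (hξ.measurable_process n k fun c => (centerOfMass c.1 : ℝ)).aemeasurable) ?_
  filter_upwards [hξ.ae_exists_stable hp0 n] with ω ⟨k, hk⟩
  refine tendsto_const_nhds.congr' ?_
  filter_upwards [eventually_ge_atTop k] with l hl
  rw [(finalConfig_eq_of_stable hk).2, process_of_stable hk hl]

theorem norm_integral_sub_integral_le {f g : Ω → ℂ} (hf : Integrable f P) (hg : Integrable g P)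
    (hf1 : ∀ ω, ‖f ω‖ ≤ 1) (hg1 : ∀ ω, ‖g ω‖ ≤ 1) {A : Set Ω} (hA : MeasurableSet A)
    (hfg : ∀ ω ∉ A, f ω = g ω) : ‖∫ ω, f ω ∂P - ∫ ω, g ω ∂P‖ ≤ 2 * P.real A := by
  rw [← integral_sub hf hg]
  have h : 2 * P.real A = ∫ ω, A.indicator (fun _ => (2 : ℝ)) ω ∂P := by
    rw [integral_indicator_const _ hA, smul_eq_mul, mul_comm]
  rw [h]
  refine norm_integral_le_of_norm_le ((integrable_const _).indicator hA)
    (Eventually.of_forall fun ω => ?_)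
  by_cases hω : ω ∈ A
  · rw [Set.indicator_of_mem hω]
    linarith [norm_sub_le (f ω) (g ω), hf1 ω, hg1 ω]
  · rw [Set.indicator_of_notMem hω, hfg ω hω, sub_self, norm_zero]

open Topology in
-- Final and horizon configurations differ only if the horizon state is unstable, an event of
-- probability `O(1/n)`.
theorem IsInstructionStack.tendsto_integral_exp_finalConfig (hξ : IsInstructionStack P p ξ)
    (hp0 : 0 < p) (hp1 : p < 1) (t : ℝ) :
    Tendsto (fun n : ℕ => ∫ ω, Complex.exp ((t / (n : ℝ) ^ (3 / 2 : ℝ) : ℝ) *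
      centerOfMass (finalConfig (fun x i => ξ x i ω) n) * Complex.I) ∂P) atTop
      (𝓝 (Real.exp (-(p * (1 - p) * t ^ 2 * (1 / (24 * p)))) : ℝ)) := by
  have hdiff : Tendsto (fun n : ℕ => (∫ ω, Complex.exp ((t / (n : ℝ) ^ (3 / 2 : ℝ) : ℝ) *
      centerOfMass (finalConfig (fun x i => ξ x i ω) n) * Complex.I) ∂P) -
      ∫ ω, Complex.exp ((t / (n : ℝ) ^ (3 / 2 : ℝ) : ℝ) *
      centerOfMass (process (fun x i => ξ x i ω) n (horizon p n)).1 * Complex.I) ∂P)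
      atTop (𝓝 0) := by
    have h0 : Tendsto (fun n : ℕ => 2 * (25 / (2 * p) / (n : ℝ))) atTop (𝓝 0) := by
      simpa using (tendsto_const_nhds.div_atTop tendsto_natCast_atTop_atTop).const_mul (2 : ℝ)
    refine squeeze_zero_norm' ?_ h0
    filter_upwards [eventually_gt_atTop 0] with n hn
    have hnorm : ∀ s : ℝ, ∀ m : ℤ, ‖Complex.exp (s * m * Complex.I)‖ ≤ 1 := fun s m => by
      have := Complex.norm_exp_ofReal_mul_I (s * m)
      push_cast at this
      exact this.le
    refine (norm_integral_sub_integral_le ?_ (hξ.integrable_process n (horizon p n)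
      fun c => Complex.exp ((t / (n : ℝ) ^ (3 / 2 : ℝ) : ℝ) * centerOfMass c.1 * Complex.I))
      (fun ω => hnorm _ _) (fun ω => hnorm _ _) (hξ.measurableSet_not_stable n (horizon p n))
      fun ω hω => ?_).trans
        (mul_le_mul_of_nonneg_left (hξ.measureReal_not_stable_le hp0 hp1 hn) zero_le_two)
    · refine Integrable.of_bound (C := 1) ?_ (Eventually.of_forall fun ω => hnorm _ _)
      have hm := hξ.aemeasurable_centerOfMass_finalConfig hp0 n
      have hc : Measurable fun m : ℝ =>
          Complex.exp ((t / (n : ℝ) ^ (3 / 2 : ℝ) : ℝ) * (m : ℂ) * Complex.I) := by fun_prop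
      have := (hc.comp_aemeasurable hm).aestronglyMeasurable
      simpa only [Function.comp_def, Complex.ofReal_intCast] using this
    · have hst : IsStableConfig (process (fun x i => ξ x i ω) n (horizon p n)).1 :=
        not_not.mp hω
      rw [(finalConfig_eq_of_stable hst).2]
  simpa using hdiff.add (hξ.tendsto_integral_exp hp0 hp1 t)

end

end StochasticSandpile

theorem mainTheorem2 {Ω : Type*} [MeasurableSpace Ω] (P : Measure Ω) [IsProbabilityMeasure P]
    (p : ℝ) (hp0 : 0 < p) (hp1 : p < 1)
    (ξ : ℤ → ℕ → Ω → StochasticSandpile.Instruction)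
    (hξ : StochasticSandpile.IsInstructionStack P p ξ) :
    (∀ n : ℕ, ∀ᵐ ω ∂P, StochasticSandpile.stabTime (fun x i => ξ x i ω) n ≠ ⊤) ∧
    TendstoInDistribution
      (fun (n : ℕ) (ω : Ω) =>
        (StochasticSandpile.centerOfMass
          (StochasticSandpile.finalConfig (fun x i => ξ x i ω) n) : ℝ) / (n : ℝ) ^ (3 / 2 : ℝ))
      atTop (id : ℝ → ℝ) (fun _ => P) (gaussianReal 0 (Real.toNNReal ((1 - p) / 12))) := by
  refine ⟨fun n => ?_, fun n => ?_, aemeasurable_id, ?_⟩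
  · filter_upwards [hξ.ae_exists_stable hp0 n] with ω ⟨k, hk⟩
    exact (StochasticSandpile.finalConfig_eq_of_stable hk).1
  · exact (hξ.aemeasurable_centerOfMass_finalConfig hp0 n).div_const _
  · refine ProbabilityMeasure.tendsto_of_tendsto_charFun fun t => ?_
    have h := hξ.tendsto_integral_exp_finalConfig hp0 hp1 t
    -- The factor `p` cancels: the exponent is `-((1 - p)/12) t²/2`.
    have hlim : ((Real.exp (-(p * (1 - p) * t ^ 2 * (1 / (24 * p)))) : ℝ) : ℂ) =
        charFun (Measure.map id (gaussianReal 0 (Real.toNNReal ((1 - p) / 12)))) t := by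
      rw [Measure.map_id, charFun_gaussianReal, Complex.ofReal_exp,
        Real.coe_toNNReal _ (by linarith)]
      congr 1
      have hp : (p : ℂ) ≠ 0 := by exact_mod_cast hp0.ne'
      push_cast
      field_simp
      ring
    change Tendsto _ _ (nhds (charFun (Measure.map id _) t))
    rw [← hlim]
    refine h.congr fun n => ?_
    change _ = charFun (Measure.map _ P) t
    rw [charFun_apply_real, integral_map
      ((hξ.aemeasurable_centerOfMass_finalConfig hp0 n).div_const _) (by fun_prop)]
    congr 1 with ω
    push_cast
    ring_nf
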